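/- **Market.** There are $m$ businesses. Business $j$ has a price $P_j\ge 0$, a fit probability $\pi_j\in(0,1)$ and a quality $Q_j\in[0,1]$. Consumers $i=1,2,\dots$ arrive one per round. Consumer $i$ has a value $V_i$, and for each business $j$ there are a binary fit $F_{ij}$ and a binary quality realization $q_{ij}$. All these variables are independent; $V_i$ has a fixed law $\mathcal D^V$ on $[0,\overline V]$, where $\overline V$ is the top of the support of $\mathcal D^V$, and $\mathbb E F_{ij}=\pi_j$, $\mathbb E q_{ij}=Q_j$. Consumers do not know $\pi_j,Q_j$; they hold a common prior under which all the fit probabilities and qualities are independent, with laws $\mathcal F_j$ and $\mathcal Q_j$ on $[0,1]$. The true parameters are possible realizations of the prior: $\pi_j\in\operatorname{supp}\mathcal F_j$ and $Q_j\in\operatorname{supp}\mathcal Q_j$. **Dynamics.** Consumer $i$ sees the history $H_{i-1}$ (the feedback of all earlier rounds) and her value $V_i$. She inspects businesses sequentially, each at most once and at cost $c\ge 0$, and each inspection reveals $F_{ij}$. At any time she may stop and transact with at most one of the businesses she has inspected. Her utility is $V_i\mathbf 1[F_{ij}=q_{ij}=1]-P_j$ if she transacts with $j$ ($0$ if she does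 not transact), minus $c$ times the number of her inspections. The feedback of the round consists of the set of inspected businesses with their fits, and of the business transacted with (if any) with its quality realization. Every consumer is Bayesian-rational: after each history of positive probability under the common prior, and for each value in $[0,\overline V]$, her search plan maximizes her expected utility under the posterior law of all the parameters given the history. Plans depend measurably on the value; ties between optimal plans may be broken in any way, in particular in favor of not inspecting. Let $\mathcal F_{ij},\mathcal Q_{ij}$ be the posterior laws of the fit probability and of the quality of business $j$ given $H_{i-1}$, let $\hat\pi_{ij},\hat Q_{ij}$ be their means, and let $$\sigma_j(\hat\pi,\hat Q,V)=V\hat Q-P_j-\frac{c}{\hat\pi}$$ be the search index of business $j$. **Proposition.** Fix such a market and a business $j$. With probability $1$ over the history (generated under the true parameters), the following holds. The beliefs $(\mathcal F_{ij},\mathcal Q_{ij})$ converge (weakly) as $i\to\infty$ to a pair of probability distributions. Moreover, at least one of the following holds: * business $j$ is *learned*: the beliefs converge in probability to the truth, that is, for every $\varepsilon>0$, $\mathcal F_{ij}(\{x:|x-\pi_j|\ge\varepsilon\})\to 0$ and $\mathcal Q_{ij}(\{x:|x-Q_j|\ge\varepsilon\})\to 0$ as $i\to\infty$; * business $j$ is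 *lost*: there is a consumer $i_0$ such that $\sigma_j(\hat\pi_{ij},\hat Q_{ij},\overline V)\le 0$ for all $i\ge i_0$. -/

import Mathlib

open MeasureTheory ProbabilityTheory Filter Topology

noncomputable section

namespace AgenticMarket

/-- A market with `m` businesses.  Business `j` has fit probability `fit j`, in `(0,1)`, quality
`quality j`, in `[0,1]`, and price `price j`.  The true parameters are possible realizations of the
prior, that is, they lie in its support.  `topValue` is the top of the support of the law of the
consumer values. -/
structure Market (m : ℕ) where
  fit : Fin m → unitInterval
  quality : Fin m → unitInterval
  price : Fin m → ℝ
  cost : ℝ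
  valueLaw : ProbabilityMeasure ℝ
  topValue : ℝ
  fitPrior : Fin m → ProbabilityMeasure unitInterval
  qualityPrior : Fin m → ProbabilityMeasure unitInterval
  fit_pos : ∀ j, 0 < (fit j : ℝ)
  fit_lt_one : ∀ j, (fit j : ℝ) < 1
  fit_mem_support : ∀ j, fit j ∈ (fitPrior j : Measure unitInterval).support
  quality_mem_support : ∀ j, quality j ∈ (qualityPrior j : Measure unitInterval).support
  price_nonneg : ∀ j, 0 ≤ price j
  cost_nonneg : 0 ≤ cost
  value_mem : ∀ᵐ v ∂(valueLaw : Measure ℝ), v ∈ Set.Icc 0 topValue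
  topValue_isTop : ∀ v < topValue, 0 < (valueLaw : Measure ℝ) (Set.Ioi v)

/-- Business parameters: `(θ j).1` is the fit probability and `(θ j).2` the quality of `j`. -/
abbrev Params (m : ℕ) := Fin m → unitInterval × unitInterval

/-- The fits `F_j` (first component) and the quality realizations `q_j` (second component) of all
the businesses for one consumer. -/
abbrev Signals (m : ℕ) := (Fin m → Bool) × (Fin m → Bool)

/-- The randomness of one round: the value of the consumer, and the signals. -/
abbrev Round (m : ℕ) := ℝ × Signals m

/-- The law of the signals of one consumer when the parameters are `θ`: all independent, with
`F_j` of mean `(θ j).1` and `q_j` of mean `(θ j).2`. -/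
def signalLaw {m : ℕ} (θ : Params m) : Measure (Signals m) :=
  (Measure.pi fun j => bernoulliMeasure true false (θ j).1).prod
    (Measure.pi fun j => bernoulliMeasure true false (θ j).2)

/-! ### Search within a round -/

/-- A search plan of one consumer: end the search, and transact with one business or with none; or inspect a
business and continue with a plan that depends on the observed fit. -/
inductive SearchPlan (m : ℕ) : Type
  | finish (choice : Option (Fin m)) : SearchPlan m
  | inspect (j : Fin m) (next : Bool → SearchPlan m) : SearchPlan m

namespace SearchPlan

variable {m : ℕ}

/-- `p.Feasible S`: when the businesses in `S` have been inspected already, `p` never inspects a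
business twice, and transacts only with businesses that have been inspected. -/
def Feasible : SearchPlan m → Finset (Fin m) → Prop
  | finish none, _ => True
  | finish (some j), S => j ∈ S
  | inspect j next, S => j ∉ S ∧ ∀ b, (next b).Feasible (insert j S)

/-- The businesses that the plan inspects when the fits are `F`. -/
def inspected (F : Fin m → Bool) : SearchPlan m → Finset (Fin m)
  | finish _ => ∅
  | inspect j next => insert j ((next (F j)).inspected F)

/-- The business, if any, that the plan transacts with when the fits are `F`. -/
def choice (F : Fin m → Bool) : SearchPlan m → Option (Fin m)
  | finish o => o
  | inspect j next => (next (F j)).choice F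

end SearchPlan

/-- The feedback of one round: for each business, whether it was inspected, and its fit if so;
and the business transacted with, if any, with its quality realization. -/
abbrev Feedback (m : ℕ) := (Fin m → Option Bool) × Option (Fin m × Bool)

/-- The feedback that the plan `p` produces on the signals `x`. -/
def feedback {m : ℕ} (p : SearchPlan m) (x : Signals m) : Feedback m :=
  (fun j => if j ∈ p.inspected x.1 then some (x.1 j) else none,
    (p.choice x.1).map fun j => (j, x.2 j))

/-! ### The market dynamics -/

/-- A strategy profile: the search plan of a consumer, given the current history (the list of the
feedback of all past rounds, the latest one last) and the value of the consumer. -/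
abbrev Strategy (m : ℕ) := List (Feedback m) → ℝ → SearchPlan m

/-- The history after the first `n` rounds, in the outcome `ω`. -/
def history {m : ℕ} (s : Strategy m) (ω : ℕ → Round m) : ℕ → List (Feedback m)
  | 0 => []
  | n + 1 => history s ω n ++ [feedback (s (history s ω n) (ω n).1) (ω n).2]

namespace Market

variable {m : ℕ} (M : Market m)

/-- The law of all the rounds when the parameters are `θ`: rounds are independent, and within a
round the value is independent of the signals. -/
def law (θ : Params m) : Measure (ℕ → Round m) :=
  Measure.infinitePi fun _ : ℕ => (M.valueLaw : Measure ℝ).prod (signalLaw θ)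

/-- The true parameters of the market. -/
def trueParams : Params m := fun j => (M.fit j, M.quality j)

/-- The common prior over the parameters: all of them are independent. -/
def prior : Measure (Params m) :=
  Measure.pi fun j =>
    (M.fitPrior j : Measure unitInterval).prod (M.qualityPrior j : Measure unitInterval)

/-- The probability that the history `h` arises (after `h.length` rounds) when the parameters
are `θ`. -/
def likelihood (s : Strategy m) (h : List (Feedback m)) (θ : Params m) : ENNReal :=
  M.law θ {ω | history s ω h.length = h}

/-- The probability of the history `h` under the common prior. -/
def evidence (s : Strategy m) (h : List (Feedback m)) : ENNReal :=
  ∫⁻ θ, M.likelihood s h θ ∂M.prior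

/-- The posterior law of the parameters given the history `h`, by Bayes' rule
(meaningful when `h` has positive probability). -/
def posterior (s : Strategy m) (h : List (Feedback m)) : Measure (Params m) :=
  (M.evidence s h)⁻¹ • M.prior.withDensity (M.likelihood s h)

/-- The posterior belief about the fit probability of `j`. -/
def fitBelief (s : Strategy m) (j : Fin m) (h : List (Feedback m)) : Measure unitInterval :=
  (M.posterior s h).map fun θ => (θ j).1

/-- The posterior belief about the quality of `j`. -/
def qualityBelief (s : Strategy m) (j : Fin m) (h : List (Feedback m)) : Measure unitInterval :=
  (M.posterior s h).map fun θ => (θ j).2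

/-- The posterior mean fit of `j`. -/
def meanFit (s : Strategy m) (j : Fin m) (h : List (Feedback m)) : ℝ :=
  ∫ x, (x : ℝ) ∂M.fitBelief s j h

/-- The posterior mean quality of `j`. -/
def meanQuality (s : Strategy m) (j : Fin m) (h : List (Feedback m)) : ℝ :=
  ∫ x, (x : ℝ) ∂M.qualityBelief s j h

/-- The total utility of a consumer with value `v` who follows the plan `p` on the signals `x`:
a transaction with `j` yields `v` if `F_j = q_j = 1`, and costs the price of `j`; each inspection
costs `M.cost`. -/
def utility (p : SearchPlan m) (v : ℝ) (x : Signals m) : ℝ :=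
  (match p.choice x.1 with
    | none => 0
    | some j => (if x.1 j = true ∧ x.2 j = true then v else 0) - M.price j)
  - M.cost * ((p.inspected x.1).card : ℝ)

/-- The expected utility of the plan `p`, for a consumer with value `v`, under the posterior
beliefs after the history `h`. -/
def expectedUtility (s : Strategy m) (h : List (Feedback m)) (v : ℝ) (p : SearchPlan m) : ℝ :=
  ∫ θ, ∫ x, M.utility p v x ∂signalLaw θ ∂M.posterior s h

/-- Bayesian rationality of a strategy profile: after every history of positive probability under
the common prior, and for every value, the plan maximizes the expected utility given the posterior
beliefs, among all feasible plans.  Ties may be broken in any way, in particular in favour of not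
inspecting.  The plan has to depend on the value in a measurable way. -/
structure IsRational (s : Strategy m) : Prop where
  measurable : ∀ h p, MeasurableSet {v | s h v = p}
  feasible : ∀ h v, M.evidence s h ≠ 0 → v ∈ Set.Icc 0 M.topValue → (s h v).Feasible ∅
  optimal : ∀ h v, M.evidence s h ≠ 0 → v ∈ Set.Icc 0 M.topValue →
    ∀ p : SearchPlan m, p.Feasible ∅ →
      M.expectedUtility s h v p ≤ M.expectedUtility s h v (s h v)

/-- The search index of `j` at mean fit `a`, mean quality `b` and value `v`. -/
def index (j : Fin m) (a b v : ℝ) : ℝ :=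
  v * b - M.price j - M.cost / a

end Market

/-! ### Convergence of beliefs -/

/-- The beliefs `μ n` are probability measures and converge to the distribution `ν` (weakly). -/
def BeliefsConverge (μ : ℕ → Measure unitInterval) (ν : ProbabilityMeasure unitInterval) : Prop :=
  ∃ μ' : ℕ → ProbabilityMeasure unitInterval,
    (∀ n, (μ' n : Measure unitInterval) = μ n) ∧ Tendsto μ' atTop (𝓝 ν)

/-- The beliefs `μ n` converge to the constant `a` in probability. -/
def BeliefsConvergeTo (μ : ℕ → Measure unitInterval) (a : unitInterval) : Prop :=
  ∀ ε : ℝ, 0 < ε → Tendsto (fun n => μ n {x | ε ≤ |(x : ℝ) - (a : ℝ)|}) atTop (𝓝 0)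

namespace Market

variable {m : ℕ} (M : Market m)

/-- Business `j` is learned in the outcome `ω`: the beliefs about its fit probability and quality
converge in probability to the true values. -/
def Learned (s : Strategy m) (j : Fin m) (ω : ℕ → Round m) : Prop :=
  BeliefsConvergeTo (fun i => M.fitBelief s j (history s ω i)) (M.fit j) ∧
  BeliefsConvergeTo (fun i => M.qualityBelief s j (history s ω i)) (M.quality j)

/-- Business `j` is lost in the outcome `ω`: from some consumer on, its search index at the top
value, evaluated at the posterior means, is non-positive. -/
def Lost (s : Strategy m) (j : Fin m) (ω : ℕ → Round m) : Prop :=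
  ∃ i₀, ∀ i ≥ i₀,
    M.index j (M.meanFit s j (history s ω i)) (M.meanQuality s j (history s ω i)) M.topValue ≤ 0

end Market

end AgenticMarket

end

noncomputable section

namespace AgenticMarket

/-! ### Dynamic programming for search plans -/

/-! The posterior is a product over businesses of Beta-type reweightings of the priors, because
consumer values do not depend on the parameters: in the likelihood of a history they contribute only
a constant factor (`exists_likelihood_eq`, `posterior_eq`). Expected utility is multilinear in the
parameters, so a rational plan is optimal for the search problem evaluated at the posterior means
(`IsRational.isOptimal`).

Beliefs about a parameter change only when it is observed. If it is observed finitely often, its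
belief is eventually constant. If it is observed infinitely often, the empirical frequency converges
to the truth (`ae_tendsto_frequency`), and the posterior concentrates there because the truth lies
in the support of the prior (`beliefsConvergeTo_bayes`). Either way the beliefs converge.

If `j` transacts infinitely often, it is also inspected infinitely often, and both parameters are
learned. Otherwise its quality belief freezes. With a positive inspection cost the fit belief
freezes too: an optimal plan inspects `j` only if some fit profile leads to a purchase from `j`, and
every fit profile has positive probability (`ae_frequently_transact_of_inspect`). With zero cost the
index does not involve the fit. So the index at the top value is eventually constant. A positive
constant would force infinitely many transactions: values near the top have positive probability,
and such a consumer buys from `j` when `j` is the only business that fits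
(`ae_frequently_transact_of_index`). Hence the constant is non-positive and `j` is lost.

The probabilistic tool throughout is a maximal inequality for nonnegative multiplicative
supermartingales along the history (`ae_bounded_weightProd`). It yields both a conditional
Borel-Cantelli lemma, by betting on the event, and the law of large numbers, by likelihood ratios.
-/

/-- The businesses whose fit is known. -/
def known {m : ℕ} (K : Fin m → Option Bool) : Finset (Fin m) :=
  Finset.univ.filter fun k => K k ≠ none

lemma mem_known {m : ℕ} {K : Fin m → Option Bool} {k : Fin m} : k ∈ known K ↔ K k ≠ none := by
  simp [known]

lemma known_update {m : ℕ} (K : Fin m → Option Bool) (k : Fin m) (b : Bool) :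
    known (Function.update K k (some b)) = insert k (known K) := by
  ext i
  by_cases h : i = k
  · subst h; simp [mem_known]
  · simp [mem_known, h]

/-- The fits `F` extend the known fits `K`. -/
def Extends {m : ℕ} (F : Fin m → Bool) (K : Fin m → Option Bool) : Prop :=
  ∀ k b, K k = some b → F k = b

lemma extends_update {m : ℕ} {F : Fin m → Bool} {K : Fin m → Option Bool} {k : Fin m}
    (hk : K k = none) {b : Bool} :
    Extends F (Function.update K k (some b)) ↔ Extends F K ∧ F k = b := by
  constructor
  · intro h
    refine ⟨fun i c hi => ?_, h k b (by simp)⟩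
    have hik : i ≠ k := by rintro rfl; simp [hk] at hi
    exact h i c (by simpa [hik] using hi)
  · rintro ⟨h, hb⟩ i c hi
    by_cases hik : i = k
    · subst hik
      simp only [Function.update_self, Option.some.injEq] at hi
      exact hb.trans hi
    · exact h i c (by simpa [hik] using hi)

lemma exists_extends {m : ℕ} (K : Fin m → Option Bool) : ∃ F, Extends F K :=
  ⟨fun k => (K k).getD true, fun k b h => by simp [h]⟩

namespace SearchPlan

variable {m : ℕ}

lemma Feasible.mem_of_choice {F : Fin m → Bool} {j : Fin m} :
    ∀ {p : SearchPlan m} {S : Finset (Fin m)}, p.Feasible S → p.choice F = some j →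
      j ∈ S ∨ j ∈ p.inspected F
  | finish none, S, _, h => by simp [choice] at h
  | finish (some k), S, hp, h => by
      simp only [choice, Option.some.injEq] at h
      exact Or.inl (h ▸ hp)
  | inspect k next, S, hp, h => by
      have := (hp.2 (F k)).mem_of_choice (F := F) h
      simp only [inspected, Finset.mem_insert] at this ⊢
      tauto

lemma Feasible.notMem_inspected {F : Fin m → Bool} {j : Fin m} :
    ∀ {p : SearchPlan m} {S : Finset (Fin m)}, p.Feasible S → j ∈ S → j ∉ p.inspected F
  | finish _, S, _, _ => by simp [inspected]
  | inspect k next, S, hp, h => by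
      have := (hp.2 (F k)).notMem_inspected (F := F) (Finset.mem_insert_of_mem h)
      simp only [inspected, Finset.mem_insert, not_or]
      refine ⟨?_, this⟩
      rintro rfl
      exact hp.1 h

/-- The expected utility of continuing with a plan when the fits in `K` are known, and the other
fits are independent with means `a`, for a consumer with value `v`, when the qualities are
independent with means `b`; the costs of earlier inspections are not counted. -/
def value (M : Market m) (a b : Fin m → ℝ) (v : ℝ) :
    SearchPlan m → (Fin m → Option Bool) → ℝ
  | finish none, _ => 0
  | finish (some k), K => (if K k = some true then v * b k else 0) - M.price k
  | inspect k next, K =>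
      -M.cost + (a k * (next true).value M a b v (Function.update K k (some true))
        + (1 - a k) * (next false).value M a b v (Function.update K k (some false)))

/-- The plan is an optimal continuation when the fits in `K` are known. -/
def IsOptimal (M : Market m) (a b : Fin m → ℝ) (v : ℝ) (p : SearchPlan m)
    (K : Fin m → Option Bool) : Prop :=
  p.Feasible (known K) ∧ ∀ q : SearchPlan m, q.Feasible (known K) →
    q.value M a b v K ≤ p.value M a b v K

/-- Bellman's principle: a better continuation on one branch could be spliced into the plan. Both
outcomes need positive probability, since optimality says nothing about a null branch. -/
lemma IsOptimal.next {M : Market m} {a b : Fin m → ℝ} {v : ℝ} {k : Fin m}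
    {next : Bool → SearchPlan m} {K : Fin m → Option Bool} (h0 : 0 < a k) (h1 : a k < 1)
    (h : IsOptimal M a b v (inspect k next) K) (c : Bool) :
    IsOptimal M a b v (next c) (Function.update K k (some c)) := by
  obtain ⟨hf, ho⟩ := h
  refine ⟨by rw [known_update]; exact hf.2 c, fun q hq => ?_⟩
  rw [known_update] at hq
  have hq' : (inspect k (Function.update next c q)).Feasible (known K) := by
    refine ⟨hf.1, fun d => ?_⟩
    by_cases hd : d = c
    · subst hd; simpa using hq
    · simpa [hd] using hf.2 d
  have := ho _ hq'
  cases c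
  · simp only [value, Function.update_self, ne_eq, Bool.true_eq_false, not_false_eq_true,
      Function.update_of_ne] at this
    have h1' : 0 < 1 - a k := by linarith
    exact le_of_mul_le_mul_left (by linarith) h1'
  · simp only [value, Function.update_self, ne_eq, Bool.false_eq_true, not_false_eq_true,
      Function.update_of_ne] at this
    exact le_of_mul_le_mul_left (by linarith) h0

/-- When the index of `j` is positive, an optimal plan transacts with `j` if only `j` fits. -/
lemma IsOptimal.choice_eq {M : Market m} {a b : Fin m → ℝ} {v : ℝ} {j : Fin m}
    (h0 : ∀ k, 0 < a k) (h1 : ∀ k, a k < 1) (hj : 0 < M.index j (a j) (b j) v) :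
    ∀ {p : SearchPlan m} {K : Fin m → Option Bool},
      Extends (fun k => decide (k = j)) K → IsOptimal M a b v p K →
      p.choice (fun k => decide (k = j)) = some j
  | finish o, K, hK, hp => by
      -- The index times `a j` is the net gain from inspecting `j` and buying exactly if it fits.
      have hpos : 0 < a j * (v * b j - M.price j) - M.cost := by
        have h := mul_pos (h0 j) hj
        have hne := (h0 j).ne'
        unfold Market.index at h
        have e : a j * (v * b j - M.price j - M.cost / a j)
          = a j * (v * b j - M.price j) - M.cost := by field_simp
        linarith
      by_contra hne
      -- No business other than `j` is known to fit, so stopping without `j` earns nothing and may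
      -- cost a price.
      have hle : (finish o : SearchPlan m).value M a b v K ≤ 0 := by
        cases o with
        | none => simp [value]
        | some k =>
          have hk : k ≠ j := by rintro rfl; exact hne rfl
          have : K k ≠ some true := fun h => by simpa [hk] using hK k true h
          simp [value, this, M.price_nonneg k]
      have hjK : K j = none ∨ K j = some true := by
        rcases h : K j with _ | _ | _
        · simp
        · simpa using hK j false h
        · simp
      -- The profitable deviation: inspect `j` and buy if it fits, or buy at once if it is already
      -- known to fit.
      rcases hjK with hn | ht
      · have := hp.2 (inspect j fun c => if c then finish (some j) else finish none)
          ⟨by simp [mem_known, hn], by rintro (_ | _) <;> simp [Feasible]⟩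
        simp only [value, if_true, Function.update_self] at this
        simp only [Bool.false_eq_true, if_false, value] at this
        linarith
      · have := hp.2 (finish (some j)) (by simp [Feasible, mem_known, ht])
        simp only [value, ht, if_true] at this
        have hc := M.cost_nonneg
        nlinarith [h0 j]
  | inspect k next, K, hK, hp => by
      refine IsOptimal.choice_eq h0 h1 hj (p := next (decide (k = j)))
        (K := Function.update K k (some (decide (k = j)))) ?_
        (hp.next (h0 k) (h1 k) _)
      have hk : K k = none := by simpa [mem_known] using hp.1.1
      exact (extends_update hk).2 ⟨hK, rfl⟩

/-- A plan that never transacts with `j` does not depend on the fit of `j`. -/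
lemma feasible_and_value_of_choice_ne {M : Market m} {a b : Fin m → ℝ} {v : ℝ} {j : Fin m}
    {c : Bool} : ∀ {p : SearchPlan m} {K : Fin m → Option Bool}, K j = none →
      p.Feasible (insert j (known K)) →
      (∀ F, Extends F (Function.update K j (some c)) → p.choice F ≠ some j) →
      p.Feasible (known K) ∧
        p.value M a b v (Function.update K j (some c)) = p.value M a b v K
  | finish none, K, hK, hp, h => by simp [Feasible, value]
  | finish (some k), K, hK, hp, h => by
      obtain ⟨F, hF⟩ := exists_extends (Function.update K j (some c))
      have hk : k ≠ j := fun hk => h F hF (by simp [choice, hk])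
      simp only [Feasible, Finset.mem_insert, hk, false_or] at hp
      simp [Feasible, value, hk, hp]
  | inspect k next, K, hK, hp, h => by
      have hk := hp.1
      simp only [Finset.mem_insert, not_or] at hk
      obtain ⟨hkj, hkK⟩ := hk
      have hkn : K k = none := by simpa [mem_known] using hkK
      have key : ∀ d, (next d).Feasible (insert k (known K)) ∧
          (next d).value M a b v (Function.update (Function.update K j (some c)) k (some d))
            = (next d).value M a b v (Function.update K k (some d)) := by
        intro d
        have := feasible_and_value_of_choice_ne (M := M) (a := a) (b := b) (v := v) (j := j)
          (c := c) (p := next d) (K := Function.update K k (some d))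
          (by rw [Function.update_of_ne (Ne.symm hkj)]; exact hK)
          (by rw [known_update, Finset.insert_comm]; exact hp.2 d)
          (fun F hF => by
            rw [Function.update_comm (Ne.symm hkj).symm] at hF
            have hF' := (extends_update (by simp [hkj, hkn])).1 hF
            have := h F hF'.1
            simpa [choice, hF'.2] using this)
        rw [known_update, Function.update_comm hkj] at this
        exact this
      refine ⟨⟨hkK, fun d => (key d).1⟩, ?_⟩
      simp only [value, (key _).2]

/-- When inspections are costly, an optimal plan that never transacts with `j` never inspects
`j`. -/
lemma IsOptimal.notMem_inspected {M : Market m} {a b : Fin m → ℝ} {v : ℝ} {j : Fin m}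
    (h0 : ∀ k, 0 < a k) (h1 : ∀ k, a k < 1) (hc : 0 < M.cost) :
    ∀ {p : SearchPlan m} {K : Fin m → Option Bool}, IsOptimal M a b v p K →
      (∀ F, Extends F K → p.choice F ≠ some j) → ∀ F, Extends F K → j ∉ p.inspected F
  | finish o, K, hp, h, F, hF => by simp [inspected]
  | inspect k next, K, hp, h, F, hF => by
      have hk : K k = none := by simpa [mem_known] using hp.1.1
      have hch : ∀ d, ∀ G, Extends G (Function.update K k (some d)) →
          (next d).choice G ≠ some j := by
        intro d G hG
        have hG' := (extends_update hk).1 hG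
        simpa [choice, hG'.2] using h G hG'.1
      have ih := IsOptimal.notMem_inspected h0 h1 hc (hp.next (h0 k) (h1 k) (F k))
        (hch (F k)) F ((extends_update hk).2 ⟨hF, rfl⟩)
      simp only [inspected, Finset.mem_insert, not_or]
      refine ⟨?_, ih⟩
      rintro rfl
      -- Both continuations are feasible without inspecting `j` and keep their values. The
      -- inspection therefore yields an average of two available values minus a positive cost, which
      -- is less than the better of the two.
      have key : ∀ d, _ := fun d => feasible_and_value_of_choice_ne (M := M) (a := a) (b := b)
        (v := v) (c := d) hk (hp.1.2 d) (hch d)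
      have ht := hp.2 _ (key true).1
      have hf := hp.2 _ (key false).1
      have e : (inspect j next).value M a b v K = -M.cost +
          (a j * (next true).value M a b v K + (1 - a j) * (next false).value M a b v K) := by
        simp only [value, (key _).2]
      have h0' := h0 j
      have h1' : 0 < 1 - a j := by linarith [h1 j]
      have := mul_le_mul_of_nonneg_left ht h0'.le
      have := mul_le_mul_of_nonneg_left hf h1'.le
      linarith

/-! ### Countability of search plans -/

/-- The number of inspections on the longest path. -/
def depth : SearchPlan m → ℕ
  | finish _ => 0
  | inspect _ next => max (next true).depth (next false).depth + 1

/-- Measurability in the value is assumed plan by plan; countability extends it to any set of plans,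
hence to the feedback. -/
instance : Countable (SearchPlan m) := by
  have h : ∀ n, {p : SearchPlan m | p.depth ≤ n}.Countable := by
    intro n
    induction n with
    | zero =>
      refine (Set.countable_range finish).mono ?_
      rintro (o | ⟨k, next⟩) hp
      · exact ⟨o, rfl⟩
      · simp [depth] at hp
    | succ n ih =>
      have := ih.to_subtype
      refine ((Set.countable_range finish).union (Set.countable_range
        fun x : Fin m × {p : SearchPlan m | p.depth ≤ n} × {p : SearchPlan m | p.depth ≤ n} =>
          inspect x.1 fun b => if b then x.2.1 else x.2.2)).mono ?_
      rintro (o | ⟨k, next⟩) hp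
      · exact Or.inl ⟨o, rfl⟩
      · simp only [Set.mem_ofPred_eq, depth, add_le_add_iff_right, max_le_iff] at hp
        refine Or.inr ⟨(k, ⟨next true, hp.1⟩, ⟨next false, hp.2⟩), ?_⟩
        simp only [inspect.injEq, true_and]
        funext b
        cases b <;> simp
  have hu : (Set.univ : Set (SearchPlan m)) = ⋃ n, {p | p.depth ≤ n} := by
    ext p
    simpa using ⟨p.depth, le_rfl⟩
  exact Set.countable_univ_iff.1 (hu ▸ Set.countable_iUnion h)

/-- A plan sees only the fits it inspects, so agreement on those forces the same path. -/
lemma inspected_congr {F G : Fin m → Bool} : ∀ {p : SearchPlan m},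
    (∀ k ∈ p.inspected F, G k = F k) →
      p.inspected G = p.inspected F ∧ p.choice G = p.choice F
  | finish _, _ => ⟨rfl, rfl⟩
  | inspect k next, h => by
      have hk : G k = F k := h k (by simp [inspected])
      have ih := inspected_congr (p := next (F k)) fun i hi => h i (by simp [inspected, hi])
      simp [inspected, choice, hk, ih]

end SearchPlan

/-! ### The law of the feedback -/

instance {m : ℕ} : MeasurableSpace (Feedback m) := ⊤

instance {m : ℕ} : MeasurableSpace (List (Feedback m)) := ⊤

instance {m : ℕ} : DiscreteMeasurableSpace (Feedback m) := ⟨fun _ => trivial⟩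

instance {m : ℕ} : DiscreteMeasurableSpace (List (Feedback m)) := ⟨fun _ => trivial⟩

instance {m : ℕ} (θ : Params m) : IsProbabilityMeasure (signalLaw θ) := by
  unfold signalLaw; infer_instance

/-- The fit of `j` that is observed in the feedback, if any. -/
def fitObs {m : ℕ} (j : Fin m) (z : Feedback m) : Option Bool := z.1 j

/-- The quality realization of `j` that is observed in the feedback, if any. -/
def qualityObs {m : ℕ} (j : Fin m) (z : Feedback m) : Option Bool :=
  z.2.bind fun y => if y.1 = j then some y.2 else none

/-- The probability of an observation of a binary variable of mean `x`; the observation `none` gives no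
information. -/
def obsProb (x : ℝ) : Option Bool → ℝ
  | none => 1
  | some true => x
  | some false => 1 - x

lemma obsProb_nonneg (x : unitInterval) (o : Option Bool) : 0 ≤ obsProb x o := by
  rcases o with _ | _ | _
  · exact zero_le_one
  · exact sub_nonneg.2 x.2.2
  · exact x.2.1

lemma obsProb_pos {x : ℝ} (h0 : 0 < x) (h1 : x < 1) (o : Option Bool) : 0 < obsProb x o := by
  rcases o with _ | _ | _ <;> simp [obsProb, h0, h1]

lemma continuous_obsProb (o : Option Bool) :
    Continuous fun x : unitInterval => obsProb x o := by
  rcases o with _ | _ | _ <;> simp only [obsProb] <;> fun_prop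

lemma bernoulliMeasure_obs (x : unitInterval) (o : Option Bool) :
    bernoulliMeasure true false x {b | ∀ c, o = some c → b = c} = ENNReal.ofReal (obsProb x o) := by
  classical
  have hx : ((unitInterval.toNNReal x : NNReal) : ENNReal) = ENNReal.ofReal x := by
    rw [← ENNReal.ofReal_coe_nnreal]; rfl
  have hx' : ((unitInterval.toNNReal (unitInterval.symm x) : NNReal) : ENNReal)
      = ENNReal.ofReal (1 - x) := by
    rw [← ENNReal.ofReal_coe_nnreal]; rfl
  rw [bernoulliMeasure_apply x (Set.toFinite _).measurableSet]
  rcases o with _ | _ | _ <;> simp [obsProb, hx, hx']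

/-- The signals that agree with the feedback. -/
def consistent {m : ℕ} (z : Feedback m) : Set (Signals m) :=
  {x | ∀ k b, fitObs k z = some b → x.1 k = b} ∩ {x | ∀ k b, qualityObs k z = some b → x.2 k = b}

/-- The probability of the feedback at the parameters `θ`, up to a factor that does not depend
on `θ`. -/
def feedbackProb {m : ℕ} (θ : Params m) (z : Feedback m) : ENNReal :=
  ∏ k, ENNReal.ofReal (obsProb (θ k).1 (fitObs k z)) *
    ENNReal.ofReal (obsProb (θ k).2 (qualityObs k z))

lemma signalLaw_consistent {m : ℕ} (θ : Params m) (z : Feedback m) :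
    signalLaw θ (consistent z) = feedbackProb θ z := by
  have h : consistent z = (Set.pi Set.univ fun k => {b | ∀ c, fitObs k z = some c → b = c}) ×ˢ
      (Set.pi Set.univ fun k => {b | ∀ c, qualityObs k z = some c → b = c}) := by
    ext x
    simp [consistent]
  rw [h, signalLaw, Measure.prod_prod, Measure.pi_pi, Measure.pi_pi, feedbackProb,
    Finset.prod_mul_distrib]
  simp only [bernoulliMeasure_obs]

/-- The feedback records every signal the plan has used. Once a plan can produce it, producing it
again only means matching the recorded signals, and this condition no longer mentions the plan. -/
lemma feedback_eq_iff {m : ℕ} {p : SearchPlan m} {x y : Signals m} :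
    feedback p y = feedback p x ↔ y ∈ consistent (feedback p x) := by
  constructor
  · intro h
    rw [← h]
    refine ⟨fun k b hb => ?_, fun k b hb => ?_⟩
    · by_cases hk : k ∈ p.inspected y.1
      · simpa [fitObs, feedback, hk] using hb
      · simp [fitObs, feedback, hk] at hb
    · simp only [qualityObs, feedback, Option.bind_map] at hb
      rcases hc : p.choice y.1 with _ | i
      · simp [hc] at hb
      · by_cases hik : i = k
        · subst hik; simpa [hc] using hb
        · simp [hc, hik] at hb
  · rintro ⟨h1, h2⟩
    have hk : ∀ k ∈ p.inspected x.1, y.1 k = x.1 k := fun k hk =>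
      h1 k (x.1 k) (by simp [fitObs, feedback, hk])
    obtain ⟨hi, hc⟩ := SearchPlan.inspected_congr hk
    refine Prod.ext (funext fun k => ?_) ?_
    · by_cases h : k ∈ p.inspected x.1
      · simp [feedback, hi, h, hk k h]
      · simp [feedback, hi, h]
    · rcases ho : p.choice x.1 with _ | i
      · simp [feedback, hc, ho]
      · have := h2 i (x.2 i) (by simp [qualityObs, feedback, ho])
        simp [feedback, hc, ho, this]

/-- The feedback of a round. -/
def roundFeedback {m : ℕ} (s : Strategy m) (h : List (Feedback m)) (r : Round m) : Feedback m :=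
  feedback (s h r.1) r.2

lemma history_succ {m : ℕ} (s : Strategy m) (ω : ℕ → Round m) (n : ℕ) :
    history s ω (n + 1) = history s ω n ++ [roundFeedback s (history s ω n) (ω n)] := rfl

lemma length_history {m : ℕ} (s : Strategy m) (ω : ℕ → Round m) (n : ℕ) :
    (history s ω n).length = n := by
  induction n with
  | zero => rfl
  | succ n ih => simp [history, ih]

lemma history_congr {m : ℕ} (s : Strategy m) {ω ω' : ℕ → Round m} {n : ℕ}
    (h : ∀ i < n, ω i = ω' i) : history s ω n = history s ω' n := by
  induction n with
  | zero => rfl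
  | succ n ih =>
    rw [history_succ, history_succ, ih fun i hi => h i (by omega), h n (by omega)]

/-! ### Measurability of the feedback and of the history -/

section Measurability

variable {m : ℕ} {s : Strategy m}

/-- The rectangle form separates the values, whose law is free of the parameters, from the signals.
This is what makes selection by the consumers harmless for inference. -/
lemma setOf_roundFeedback_eq (s : Strategy m) (h : List (Feedback m)) (z : Feedback m) :
    {r | roundFeedback s h r = z} = {v | ∃ x, feedback (s h v) x = z} ×ˢ consistent z := by
  ext ⟨v, x⟩
  simp only [Set.mem_prod, Set.mem_ofPred_eq, roundFeedback]
  constructor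
  · rintro rfl
    exact ⟨⟨x, rfl⟩, feedback_eq_iff.1 rfl⟩
  · rintro ⟨⟨y, rfl⟩, hx⟩
    exact feedback_eq_iff.2 hx

lemma measurable_roundFeedback (hs : ∀ h p, MeasurableSet {v | s h v = p})
    (h : List (Feedback m)) : Measurable (roundFeedback s h) := by
  refine measurable_to_countable' fun z => ?_
  have e : roundFeedback s h ⁻¹' {z} = {r | roundFeedback s h r = z} := rfl
  rw [e, setOf_roundFeedback_eq]
  refine MeasurableSet.prod ?_ (Set.toFinite _).measurableSet
  have e2 : {v | ∃ x, feedback (s h v) x = z}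
      = ⋃ p : {p : SearchPlan m // ∃ x, feedback p x = z}, {v | s h v = p} := by
    ext v
    simp only [Set.mem_ofPred_eq, Set.mem_iUnion, Subtype.exists, exists_prop]
    exact ⟨fun hv => ⟨_, hv, rfl⟩, fun ⟨p, hp, e⟩ => e ▸ hp⟩
  rw [e2]
  exact MeasurableSet.iUnion fun p => hs h p

lemma measurable_history (hs : ∀ h p, MeasurableSet {v | s h v = p}) (n : ℕ) :
    Measurable fun ω => history s ω n := by
  induction n with
  | zero => exact measurable_const
  | succ n ih =>
    have h1 : Measurable fun y : List (Feedback m) × Round m => y.1 ++ [roundFeedback s y.1 y.2] :=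
      measurable_from_prod_countable_right fun h =>
        (Measurable.of_discrete (f := fun z : Feedback m => h ++ [z])).comp
          (measurable_roundFeedback hs h)
    exact h1.comp (ih.prodMk (measurable_pi_apply n))

end Measurability

namespace Market

variable {m : ℕ} (M : Market m)

/-- The law of one round at the parameters `θ`. -/
def roundLaw (θ : Params m) : Measure (Round m) :=
  (M.valueLaw : Measure ℝ).prod (signalLaw θ)

instance (θ : Params m) : IsProbabilityMeasure (M.roundLaw θ) := by
  unfold roundLaw; infer_instance

instance (θ : Params m) : IsProbabilityMeasure (M.law θ) := by
  unfold law; infer_instance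

instance : IsProbabilityMeasure M.prior := by
  unfold prior; infer_instance

lemma roundLaw_feedback (s : Strategy m) (h : List (Feedback m)) (z : Feedback m)
    (θ : Params m) : M.roundLaw θ {r | roundFeedback s h r = z}
      = (M.valueLaw : Measure ℝ) {v | ∃ x, feedback (s h v) x = z} * feedbackProb θ z := by
  rw [setOf_roundFeedback_eq, roundLaw, Measure.prod_prod, signalLaw_consistent]

variable {s : Strategy m}

/-! ### Independence of a round from its past -/

lemma indepFun_history (hs : ∀ h p, MeasurableSet {v | s h v = p}) (θ : Params m) (n : ℕ) :
    IndepFun (fun ω => history s ω n) (fun ω : ℕ → Round m => ω n) (M.law θ) := by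
  have h := iIndepFun_infinitePi (P := fun _ : ℕ => M.roundLaw θ) (X := fun _ r => r)
    (fun _ => measurable_id)
  have h2 := h.indepFun_finset (Finset.range n) {n} (by simp) (fun i => measurable_pi_apply i)
  -- Padding the first `n` rounds by a default exhibits the history as a function of these rounds
  -- alone.
  let ext : (Finset.range n → Round m) → ℕ → Round m := fun y i =>
    if hi : i ∈ Finset.range n then y ⟨i, hi⟩ else default
  have hext : Measurable ext := by
    refine measurable_pi_lambda _ fun i => ?_
    by_cases hi : i ∈ Finset.range n
    · simp only [ext, hi, dite_true]; exact measurable_pi_apply _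
    · simp only [ext, hi, dite_false]; exact measurable_const
  have h3 := h2.comp ((measurable_history hs n).comp hext)
    (measurable_pi_apply (⟨n, by simp⟩ : ({n} : Finset ℕ)))
  have e : (fun ω => history s ω n) = ((fun ω => history s ω n) ∘ ext) ∘
      fun ω (i : Finset.range n) => ω i := by
    funext ω
    refine history_congr s fun i hi => ?_
    simp [ext, hi]
  rw [e]
  exact h3

lemma map_history_prod (hs : ∀ h p, MeasurableSet {v | s h v = p}) (θ : Params m) (n : ℕ) :
    (M.law θ).map (fun ω => (history s ω n, ω n))
      = ((M.law θ).map fun ω => history s ω n).prod (M.roundLaw θ) := by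
  have h := (M.indepFun_history hs θ n).map_prod_eq_prod_map_map
    (measurable_history hs n).aemeasurable (measurable_pi_apply n).aemeasurable
  rw [h]
  congr 1
  exact Measure.infinitePi_map_eval (fun _ : ℕ => M.roundLaw θ) n

lemma lintegral_history (hs : ∀ h p, MeasurableSet {v | s h v = p}) (θ : Params m) (n : ℕ)
    {f : List (Feedback m) → Round m → ENNReal} (hf : ∀ h, Measurable (f h)) :
    ∫⁻ ω, f (history s ω n) (ω n) ∂M.law θ
      = ∫⁻ ω, ∫⁻ r, f (history s ω n) r ∂M.roundLaw θ ∂M.law θ := by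
  have hf' : Measurable (Function.uncurry f) := measurable_from_prod_countable_right hf
  have h1 := lintegral_map (μ := M.law θ) hf'
    ((measurable_history hs n).prodMk (measurable_pi_apply n))
  have h2 := lintegral_map (μ := M.law θ)
    (f := fun h => ∫⁻ r, f h r ∂M.roundLaw θ) Measurable.of_discrete (measurable_history hs n)
  rw [map_history_prod M hs, lintegral_prod _ hf'.aemeasurable] at h1
  exact h1.symm.trans h2

lemma likelihood_append (hs : ∀ h p, MeasurableSet {v | s h v = p}) (h : List (Feedback m))
    (z : Feedback m) (θ : Params m) :
    M.likelihood s (h ++ [z]) θ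
      = M.likelihood s h θ * M.roundLaw θ {r | roundFeedback s h r = z} := by
  have hm : Measurable fun ω : ℕ → Round m => (history s ω h.length, ω h.length) :=
    (measurable_history hs _).prodMk (measurable_pi_apply _)
  have hB : MeasurableSet {r | roundFeedback s h r = z} :=
    measurable_roundFeedback hs h (measurableSet_singleton z)
  have e : {ω | history s ω (h ++ [z]).length = h ++ [z]}
      = (fun ω : ℕ → Round m => (history s ω h.length, ω h.length)) ⁻¹'
        ({h} ×ˢ {r | roundFeedback s h r = z}) := by
    ext ω
    simp only [List.length_append, List.length_singleton, Set.mem_ofPred_eq, Set.mem_preimage,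
      Set.mem_prod, Set.mem_singleton_iff, history_succ]
    constructor
    · intro hω
      obtain ⟨h1, h2⟩ := List.append_inj' hω rfl
      rw [h1] at h2
      exact ⟨h1, by simpa using h2⟩
    · rintro ⟨h1, h2⟩
      rw [h1, h2]
  rw [likelihood, e, ← Measure.map_apply hm ((measurableSet_singleton h).prod hB),
    map_history_prod M hs, Measure.prod_prod,
    Measure.map_apply (measurable_history hs _) (measurableSet_singleton h)]
  rfl

end Market

/-! ### A maximal inequality along the history -/

/-- The product of the weights `w` along a history that is listed backwards. -/
def weightProdAux {m : ℕ} (w : List (Feedback m) → Feedback m → ENNReal) :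
    List (Feedback m) → ENNReal
  | [] => 1
  | z :: t => weightProdAux w t * w t.reverse z

/-- The product of the weights `w` along a history. -/
def weightProd {m : ℕ} (w : List (Feedback m) → Feedback m → ENNReal)
    (h : List (Feedback m)) : ENNReal :=
  weightProdAux w h.reverse

section WeightProd

variable {m : ℕ} (w : List (Feedback m) → Feedback m → ENNReal)

@[simp] lemma weightProd_nil : weightProd w [] = 1 := rfl

@[simp] lemma weightProd_append (h : List (Feedback m)) (z : Feedback m) :
    weightProd w (h ++ [z]) = weightProd w h * w h z := by
  simp [weightProd, weightProdAux]

open Classical in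
/-- The weights `w`, stopped when their product has reached `K`. -/
def stoppedWeight (K : ENNReal) (h : List (Feedback m)) (z : Feedback m) : ENNReal :=
  if ∃ h', h' <+: h ∧ K ≤ weightProd w h' then 1 else w h z

/-- Stopping turns "the product has reached `K` at some time" into a statement about the final
product, to which Markov's inequality applies. -/
lemma weightProd_stoppedWeight (K : ENNReal) (h : List (Feedback m)) :
    ((∃ h', h' <+: h ∧ K ≤ weightProd w h') → K ≤ weightProd (stoppedWeight w K) h) ∧
    ((¬ ∃ h', h' <+: h ∧ K ≤ weightProd w h') →
      weightProd (stoppedWeight w K) h = weightProd w h) := by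
  induction h using List.reverseRecOn with
  | nil => simp
  | append_singleton h z ih =>
    by_cases hex : ∃ h', h' <+: h ∧ K ≤ weightProd w h'
    · have e : stoppedWeight w K h z = 1 := if_pos hex
      refine ⟨fun _ => by simpa [e] using ih.1 hex, fun hn => ?_⟩
      obtain ⟨h', h1, h2⟩ := hex
      exact absurd ⟨h', h1.trans (List.prefix_append _ _), h2⟩ hn
    · have e : stoppedWeight w K h z = w h z := if_neg hex
      have e2 : weightProd (stoppedWeight w K) (h ++ [z]) = weightProd w (h ++ [z]) := by
        simp [e, ih.2 hex]
      refine ⟨?_, fun _ => e2⟩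
      rintro ⟨h', h1, h2⟩
      rw [e2]
      rcases List.prefix_concat_iff.1 h1 with rfl | h3
      · exact h2
      · exact absurd ⟨h', h3, h2⟩ hex

end WeightProd

lemma history_prefix {m : ℕ} (s : Strategy m) (ω : ℕ → Round m) {k n : ℕ} (hkn : k ≤ n) :
    history s ω k <+: history s ω n := by
  induction n, hkn using Nat.le_induction with
  | base => exact List.prefix_rfl
  | succ n _ ih => exact ih.trans (List.prefix_append _ _)

namespace Market

variable {m : ℕ} (M : Market m) {s : Strategy m}

/-- The product is a nonnegative supermartingale started at `1`; the current round is integrated out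
given the past. -/
lemma lintegral_weightProd_le (hs : ∀ h p, MeasurableSet {v | s h v = p}) (θ : Params m)
    {w : List (Feedback m) → Feedback m → ENNReal}
    (hw : ∀ h, ∫⁻ r, w h (roundFeedback s h r) ∂M.roundLaw θ ≤ 1) (n : ℕ) :
    ∫⁻ ω, weightProd w (history s ω n) ∂M.law θ ≤ 1 := by
  induction n with
  | zero => simp [history]
  | succ n ih =>
    have hm : ∀ h, Measurable fun r => w h (roundFeedback s h r) := fun h =>
      (Measurable.of_discrete (f := w h)).comp (measurable_roundFeedback hs h)
    calc ∫⁻ ω, weightProd w (history s ω (n + 1)) ∂M.law θ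
        = ∫⁻ ω, weightProd w (history s ω n) *
            w (history s ω n) (roundFeedback s (history s ω n) (ω n)) ∂M.law θ := by
          simp only [history_succ, weightProd_append]
      _ = ∫⁻ ω, ∫⁻ r, weightProd w (history s ω n) *
            w (history s ω n) (roundFeedback s (history s ω n) r) ∂M.roundLaw θ ∂M.law θ :=
          M.lintegral_history hs θ n
            (f := fun h r => weightProd w h * w h (roundFeedback s h r))
            fun h => (hm h).const_mul _
      _ ≤ ∫⁻ ω, weightProd w (history s ω n) ∂M.law θ := by
          refine lintegral_mono fun ω => ?_
          rw [lintegral_const_mul _ (hm _)]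
          exact mul_le_of_le_one_right' (hw _)
      _ ≤ 1 := ih

/-- If the conditional means of the weights are at most one, their products along the history
stay bounded. -/
theorem ae_bounded_weightProd (hs : ∀ h p, MeasurableSet {v | s h v = p}) (θ : Params m)
    {w : List (Feedback m) → Feedback m → ENNReal}
    (hw : ∀ h, ∫⁻ r, w h (roundFeedback s h r) ∂M.roundLaw θ ≤ 1) :
    ∀ᵐ ω ∂M.law θ, ∃ K : ℕ, ∀ n, weightProd w (history s ω n) < K := by
  have key : ∀ K : ℕ, K ≠ 0 →
      M.law θ {ω | ∃ n, (K : ENNReal) ≤ weightProd w (history s ω n)} ≤ (K : ENNReal)⁻¹ := by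
    intro K hK
    have e : {ω | ∃ n, (K : ENNReal) ≤ weightProd w (history s ω n)}
        = ⋃ n, {ω | ∃ k ≤ n, (K : ENNReal) ≤ weightProd w (history s ω k)} := by
      ext ω
      simp only [Set.mem_ofPred_eq, Set.mem_iUnion]
      exact ⟨fun ⟨n, hn⟩ => ⟨n, n, le_rfl, hn⟩, fun ⟨_, k, _, hk⟩ => ⟨k, hk⟩⟩
    have hmono : Monotone fun n => {ω | ∃ k ≤ n, (K : ENNReal) ≤ weightProd w (history s ω k)} :=
      fun a b hab ω ⟨k, hk, h⟩ => ⟨k, hk.trans hab, h⟩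
    rw [e, hmono.measure_iUnion]
    refine iSup_le fun n => ?_
    have hw' : ∀ h, ∫⁻ r, stoppedWeight w K h (roundFeedback s h r) ∂M.roundLaw θ ≤ 1 := by
      intro h
      by_cases hex : ∃ h', h' <+: h ∧ (K : ENNReal) ≤ weightProd w h'
      · have : ∀ z, stoppedWeight w K h z = 1 := fun z => if_pos hex
        simp [this]
      · have : ∀ z, stoppedWeight w K h z = w h z := fun z => if_neg hex
        simpa [this] using hw h
    calc M.law θ {ω | ∃ k ≤ n, (K : ENNReal) ≤ weightProd w (history s ω k)}
        ≤ M.law θ {ω | (K : ENNReal) ≤ weightProd (stoppedWeight w K) (history s ω n)} := by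
          refine measure_mono fun ω ⟨k, hk, h⟩ => ?_
          exact (weightProd_stoppedWeight w K _).1 ⟨_, history_prefix s ω hk, h⟩
      _ ≤ (∫⁻ ω, weightProd (stoppedWeight w K) (history s ω n) ∂M.law θ) / K :=
          meas_ge_le_lintegral_div
            ((Measurable.of_discrete (f := weightProd (stoppedWeight w K))).comp
              (measurable_history hs n)).aemeasurable (by simpa using hK) (by simp)
      _ ≤ (K : ENNReal)⁻¹ := by
          rw [ENNReal.div_eq_inv_mul]
          exact mul_le_of_le_one_right' (M.lintegral_weightProd_le hs θ hw' n)
  have hzero : M.law θ {ω | ¬ ∃ K : ℕ, ∀ n, weightProd w (history s ω n) < K} = 0 := by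
    by_contra hne
    obtain ⟨K, hK⟩ := ENNReal.exists_inv_nat_lt hne
    rcases eq_or_ne K 0 with rfl | hK0
    · simp at hK
    · refine absurd ((measure_mono fun ω hω => ?_).trans (key K hK0)) (not_le.2 hK)
      by_contra hn
      simp only [Set.mem_ofPred_eq, not_exists, not_le] at hn
      exact hω ⟨K, hn⟩
  exact hzero

/-- A conditional Borel-Cantelli lemma: if in each round the conditional probability of the event `T`
is at least `ρ` times that of `B`, and `B` occurs infinitely often, then so does `T`. -/
theorem ae_frequently_of_frequently (hs : ∀ h p, MeasurableSet {v | s h v = p}) (θ : Params m)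
    {B T : List (Feedback m) → Feedback m → Prop} {ρ : NNReal} (hρ : 0 < ρ)
    (hBT : ∀ h, ρ * M.roundLaw θ {r | B h (roundFeedback s h r)}
      ≤ M.roundLaw θ {r | T h (roundFeedback s h r)}) :
    ∀ᵐ ω ∂M.law θ,
      (∃ᶠ n in atTop, B (history s ω n) (roundFeedback s (history s ω n) (ω n))) →
      ∃ᶠ n in atTop, T (history s ω n) (roundFeedback s (history s ω n) (ω n)) := by
  classical
  -- A bet against `T`: half the capital is lost on `T`, and a factor `1 + ρ / 2` is won on `B`
  -- without `T`. The conditional mean is at most `1 + (ρ * P(B) - P(T)) / 2 ≤ 1`.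
  let w : List (Feedback m) → Feedback m → ENNReal := fun h z =>
    if T h z then 2⁻¹ else if B h z then 1 + ρ / 2 else 1
  have hmT : ∀ h, MeasurableSet {r | T h (roundFeedback s h r)} := fun h =>
    measurable_roundFeedback hs h (t := {z | T h z}) trivial
  have hmB : ∀ h, MeasurableSet {r | B h (roundFeedback s h r)} := fun h =>
    measurable_roundFeedback hs h (t := {z | B h z}) trivial
  have hw : ∀ h, ∫⁻ r, w h (roundFeedback s h r) ∂M.roundLaw θ ≤ 1 := by
    intro h
    -- The loss is moved to the left-hand side to avoid truncated subtraction.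
    have hle : ∀ r, w h (roundFeedback s h r)
        + 2⁻¹ * {r | T h (roundFeedback s h r)}.indicator 1 r
        ≤ 1 + ρ / 2 * {r | B h (roundFeedback s h r)}.indicator 1 r := by
      intro r
      by_cases hT : T h (roundFeedback s h r)
      · simp [w, hT, ENNReal.inv_two_add_inv_two]
      · by_cases hB : B h (roundFeedback s h r) <;> simp [w, hT, hB]
    have h1 := lintegral_mono (μ := M.roundLaw θ) hle
    have hmw : Measurable fun r => w h (roundFeedback s h r) :=
      (Measurable.of_discrete (f := w h)).comp (measurable_roundFeedback hs h)
    rw [lintegral_add_left hmw, lintegral_const_mul _ (measurable_one.indicator (hmT h)),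
      lintegral_add_left measurable_const, lintegral_const_mul _
      (measurable_one.indicator (hmB h)), lintegral_indicator_one (hmT h),
      lintegral_indicator_one (hmB h), lintegral_const, measure_univ, mul_one] at h1
    have h2 : (ρ : ENNReal) / 2 * M.roundLaw θ {r | B h (roundFeedback s h r)}
        ≤ 2⁻¹ * M.roundLaw θ {r | T h (roundFeedback s h r)} := by
      rw [ENNReal.div_eq_inv_mul, mul_assoc]
      gcongr
      exact hBT h
    have hfin : 2⁻¹ * M.roundLaw θ {r | T h (roundFeedback s h r)} ≠ ⊤ :=
      ENNReal.mul_ne_top (by simp) (measure_ne_top _ _)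
    exact (ENNReal.add_le_add_iff_right hfin).1 (h1.trans (by gcongr))
  filter_upwards [M.ae_bounded_weightProd hs θ hw] with ω ⟨K, hK⟩ hB
  by_contra hT
  rw [not_frequently, eventually_atTop] at hT
  obtain ⟨N, hN⟩ := hT
  have hw0 : ∀ h z, w h z ≠ 0 := by
    intro h z
    simp only [w]
    split_ifs <;> simp
  have hpos : ∀ h, weightProd w h ≠ 0 := by
    intro h
    induction h using List.reverseRecOn with
    | nil => simp
    | append_singleton h z ih => simpa using ⟨ih, hw0 h z⟩
  have hmono : ∀ n ≥ N, ∀ k ≥ n, weightProd w (history s ω n) ≤ weightProd w (history s ω k) := by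
    intro n hn k hk
    induction k, hk using Nat.le_induction with
    | base => exact le_rfl
    | succ k hk ih =>
      rw [history_succ, weightProd_append]
      refine ih.trans (le_mul_of_one_le_right' ?_)
      simp only [w, if_neg (hN k (hn.trans hk))]
      split_ifs <;> simp
  -- After the last occurrence of `T` the capital never falls, and each `B` multiplies it by `1 + ρ
  -- / 2`, so infinitely many `B` would make it unbounded.
  have hpow : ∀ i : ℕ, ∃ n ≥ N,
      weightProd w (history s ω N) * (1 + ρ / 2) ^ i ≤ weightProd w (history s ω n) := by
    intro i
    induction i with
    | zero => exact ⟨N, le_rfl, by simp⟩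
    | succ i ih =>
      obtain ⟨n, hn, hle⟩ := ih
      obtain ⟨k, hk, hBk⟩ := frequently_atTop.1 hB n
      refine ⟨k + 1, by omega, ?_⟩
      rw [history_succ, weightProd_append, pow_succ, ← mul_assoc]
      have e : w (history s ω k) (roundFeedback s (history s ω k) (ω k)) = 1 + ρ / 2 := by
        simp only [w, if_neg (hN k (hn.trans hk)), if_pos hBk]
      rw [e]
      gcongr
      exact hle.trans (hmono n hn k hk)
  have hlim : Tendsto (fun i : ℕ => weightProd w (history s ω N) * (1 + (ρ : ENNReal) / 2) ^ i)
      atTop (𝓝 ⊤) := by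
    have h1 : (1 : ENNReal) < 1 + ρ / 2 :=
      ENNReal.lt_add_right (by simp) (by simpa using hρ.ne')
    have := ENNReal.Tendsto.const_mul (a := weightProd w (history s ω N))
      (ENNReal.tendsto_pow_atTop_nhds_top_iff.2 h1) (Or.inl (by simp))
    rwa [ENNReal.mul_top (hpos _)] at this
  obtain ⟨i, hi⟩ := ((hlim.eventually (lt_mem_nhds (ENNReal.natCast_lt_top K))).exists)
  obtain ⟨n, _, hn⟩ := hpow i
  exact absurd (hK n) (not_lt.2 (hi.le.trans hn))

end Market

/-! ### The likelihood, and the law of large numbers for the observations -/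

/-- The number of times that the value `b` is observed along a history. -/
def obsCount {m : ℕ} (obs : Feedback m → Option Bool) (b : Bool) (h : List (Feedback m)) : ℕ :=
  h.countP fun z => obs z = some b

lemma obsCount_append {m : ℕ} (obs : Feedback m → Option Bool) (b : Bool)
    (h : List (Feedback m)) (z : Feedback m) :
    obsCount obs b (h ++ [z]) = obsCount obs b h + if obs z = some b then 1 else 0 := by
  by_cases hz : obs z = some b <;> simp [obsCount, List.countP_append, hz]

/-- The likelihood of the mean `x` given the observations in a history. -/
def obsLikelihood {m : ℕ} (obs : Feedback m → Option Bool) (h : List (Feedback m)) (x : ℝ) : ℝ :=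
  x ^ obsCount obs true h * (1 - x) ^ obsCount obs false h

lemma obsLikelihood_append {m : ℕ} (obs : Feedback m → Option Bool) (h : List (Feedback m))
    (z : Feedback m) (x : ℝ) :
    obsLikelihood obs (h ++ [z]) x = obsLikelihood obs h x * obsProb x (obs z) := by
  rcases hz : obs z with _ | _ | _ <;> simp [obsLikelihood, obsCount_append, hz, obsProb] <;> ring

lemma obsLikelihood_nonneg {m : ℕ} (obs : Feedback m → Option Bool) (h : List (Feedback m))
    (x : unitInterval) : 0 ≤ obsLikelihood obs h x :=
  mul_nonneg (pow_nonneg x.2.1 _) (pow_nonneg (sub_nonneg.2 x.2.2) _)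

/-- Relative entropy is positive. -/
lemma entropy_pos {a x : ℝ} (ha0 : 0 < a) (ha1 : a < 1) (hx0 : 0 < x) (hx1 : x < 1)
    (hne : a ≠ x) : 0 < a * Real.log (a / x) + (1 - a) * Real.log ((1 - a) / (1 - x)) := by
  have ha1' : 0 < 1 - a := by linarith
  have hx1' : 0 < 1 - x := by linarith
  have h1 : Real.log (x / a) < x / a - 1 :=
    Real.log_lt_sub_one_of_pos (by positivity) (by rw [Ne, div_eq_one_iff_eq ha0.ne']; exact hne.symm)
  have h2 : Real.log ((1 - x) / (1 - a)) ≤ (1 - x) / (1 - a) - 1 :=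
    Real.log_le_sub_one_of_pos (by positivity)
  rw [← inv_div x a, ← inv_div (1 - x) (1 - a), Real.log_inv, Real.log_inv]
  have h3 := mul_lt_mul_of_pos_left h1 ha0
  have h4 := mul_le_mul_of_nonneg_left h2 ha1'.le
  have e1 : a * (x / a - 1) = x - a := by field_simp
  have e2 : (1 - a) * ((1 - x) / (1 - a) - 1) = a - x := by field_simp; ring
  linarith

/-- If the likelihood ratios at the rational means stay bounded, the frequencies converge. -/
lemma tendsto_frequency {x : ℝ} (hx0 : 0 < x) (hx1 : x < 1) {s f : ℕ → ℕ}
    (hb : ∀ q : ℚ, 0 < (q : ℝ) → (q : ℝ) < 1 →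
      ∃ K : ℕ, ∀ n, ((q : ℝ) / x) ^ s n * ((1 - q) / (1 - x)) ^ f n < K)
    (hn : Tendsto (fun n => s n + f n) atTop atTop) :
    Tendsto (fun n => (s n : ℝ) / ((s n + f n : ℕ) : ℝ)) atTop (𝓝 x) := by
  have hx1' : 0 < 1 - x := by linarith
  -- Per observation, the log likelihood ratio is an affine function of the frequency whose value at
  -- `q` is the relative entropy `D > 0`. The total stays below `log K`, so eventually the function
  -- at the actual frequency lies below its value at `q`.
  have key : ∀ q : ℚ, 0 < (q : ℝ) → (q : ℝ) < 1 → (q : ℝ) ≠ x → ∀ᶠ n in atTop,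
      0 < ((s n + f n : ℕ) : ℝ) ∧
      (s n : ℝ) / ((s n + f n : ℕ) : ℝ) * Real.log (q / x)
        + (1 - (s n : ℝ) / ((s n + f n : ℕ) : ℝ)) * Real.log ((1 - q) / (1 - x))
      < q * Real.log (q / x) + (1 - q) * Real.log ((1 - q) / (1 - x)) := by
    intro q hq0 hq1 hqx
    have hq1' : 0 < 1 - (q : ℝ) := by linarith
    obtain ⟨K, hK⟩ := hb q hq0 hq1
    have hD := entropy_pos hq0 hq1 hx0 hx1 hqx
    set D := (q : ℝ) * Real.log (q / x) + (1 - q) * Real.log ((1 - q) / (1 - x))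
    have hn' : Tendsto (fun n => ((s n + f n : ℕ) : ℝ) * D) atTop atTop :=
      (tendsto_natCast_atTop_atTop.comp hn).atTop_mul_const hD
    filter_upwards [hn'.eventually_gt_atTop (Real.log K), hn.eventually_gt_atTop 0] with n h1 h2
    have h2' : 0 < ((s n + f n : ℕ) : ℝ) := by exact_mod_cast h2
    refine ⟨h2', ?_⟩
    have h3 := Real.log_lt_log (by positivity) (hK n)
    rw [Real.log_mul (by positivity) (by positivity), Real.log_pow, Real.log_pow] at h3
    refine lt_of_mul_lt_mul_left ?_ h2'.le
    refine lt_of_eq_of_lt ?_ (h3.trans h1)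
    have hne := h2'.ne'
    field_simp
    push_cast
    ring
  rw [tendsto_order]
  constructor
  -- For `q < x` the affine function is decreasing, so the frequency exceeds `q`; the other bound is
  -- symmetric.
  · intro l hl
    obtain ⟨q, hq1, hq2⟩ := exists_rat_btwn (max_lt hl hx0)
    rw [max_lt_iff] at hq1
    have hq1' : 0 < 1 - (q : ℝ) := by linarith
    filter_upwards [key q hq1.2 (hq2.trans hx1) hq2.ne] with n ⟨hp, h⟩
    have l1 : Real.log (q / x) < 0 :=
      Real.log_neg (div_pos hq1.2 hx0) ((div_lt_one hx0).2 hq2)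
    have l2 : 0 < Real.log ((1 - q) / (1 - x)) :=
      Real.log_pos ((one_lt_div hx1').2 (by linarith))
    refine hq1.1.trans ?_
    by_contra hle
    nlinarith
  · intro u hu
    obtain ⟨q, hq1, hq2⟩ := exists_rat_btwn (lt_min hu hx1)
    rw [lt_min_iff] at hq2
    have hq0 := hx0.trans hq1
    filter_upwards [key q hq0 hq2.2 hq1.ne'] with n ⟨hp, h⟩
    have l1 : 0 < Real.log (q / x) := Real.log_pos ((one_lt_div hx0).2 hq1)
    have l2 : Real.log ((1 - q) / (1 - x)) < 0 :=
      Real.log_neg (div_pos (by linarith) hx1') ((div_lt_one hx1').2 (by linarith))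
    refine lt_of_not_ge fun hle => ?_
    have := hq2.1.trans_le hle
    nlinarith

namespace Market

variable {m : ℕ} (M : Market m) {s : Strategy m}

lemma lintegral_roundFeedback (hs : ∀ h p, MeasurableSet {v | s h v = p}) (θ : Params m)
    (h : List (Feedback m)) (f : Feedback m → ENNReal) :
    ∫⁻ r, f (roundFeedback s h r) ∂M.roundLaw θ
      = ∑ z, f z * M.roundLaw θ {r | roundFeedback s h r = z} := by
  have hm := measurable_roundFeedback hs h
  rw [← lintegral_map (Measurable.of_discrete (f := f)) hm, lintegral_fintype]
  refine Finset.sum_congr rfl fun z _ => ?_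
  rw [Measure.map_apply hm (measurableSet_singleton z)]
  rfl

/-- The strong law of large numbers for observations whose number depends on the history: if
they are infinitely many, their frequency converges to the true mean. -/
theorem ae_tendsto_frequency (hs : ∀ h p, MeasurableSet {v | s h v = p}) (θ : Params m)
    {obs : Feedback m → Option Bool} {x : unitInterval} (hx0 : 0 < (x : ℝ)) (hx1 : (x : ℝ) < 1)
    (hobs : ∀ a : unitInterval, ∃ θ' : Params m, ∀ z,
      ENNReal.ofReal (obsProb x (obs z)) * feedbackProb θ' z
        = ENNReal.ofReal (obsProb a (obs z)) * feedbackProb θ z) :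
    ∀ᵐ ω ∂M.law θ,
      Tendsto (fun n => obsCount obs true (history s ω n) + obsCount obs false (history s ω n))
        atTop atTop →
      Tendsto (fun n => (obsCount obs true (history s ω n) : ℝ) /
        ((obsCount obs true (history s ω n) + obsCount obs false (history s ω n) : ℕ) : ℝ))
        atTop (𝓝 (x : ℝ)) := by
  -- Rational means suffice, and there are countably many of them, so one null set serves for all.
  have hb : ∀ᵐ ω ∂M.law θ, ∀ q : ℚ, 0 < (q : ℝ) → (q : ℝ) < 1 →
      ∃ K : ℕ, ∀ n, ((q : ℝ) / x) ^ obsCount obs true (history s ω n) *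
        ((1 - q) / (1 - x)) ^ obsCount obs false (history s ω n) < K := by
    refine ae_all_iff.2 fun q => ?_
    by_cases hq : 0 < (q : ℝ) ∧ (q : ℝ) < 1
    swap
    · exact Eventually.of_forall fun ω h0 h1 => absurd ⟨h0, h1⟩ hq
    obtain ⟨hq0, hq1⟩ := hq
    obtain ⟨θ', hθ'⟩ := hobs ⟨q, hq0.le, hq1.le⟩
    -- The likelihood ratio of mean `q` against mean `x`. Its conditional mean is exactly `1`, since
    -- it turns the feedback law at `θ` into that at `θ'`.
    let w : List (Feedback m) → Feedback m → ENNReal := fun _ z =>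
      ENNReal.ofReal (obsProb q (obs z) / obsProb x (obs z))
    have hwm : ∀ z, ENNReal.ofReal (obsProb q (obs z) / obsProb x (obs z)) * feedbackProb θ z
        = feedbackProb θ' z := by
      intro z
      have hp := obsProb_pos hx0 hx1 (obs z)
      have h0 : ENNReal.ofReal (obsProb x (obs z)) ≠ 0 := by simpa using hp
      rw [ENNReal.ofReal_div_of_pos hp, ENNReal.div_eq_inv_mul, mul_assoc, ← hθ' z, ← mul_assoc,
        ENNReal.inv_mul_cancel h0 ENNReal.ofReal_ne_top, one_mul]
    have hw : ∀ h, ∫⁻ r, w h (roundFeedback s h r) ∂M.roundLaw θ ≤ 1 := by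
      intro h
      have h1 := M.lintegral_roundFeedback hs θ' h fun _ => 1
      simp only [lintegral_const, measure_univ, one_mul] at h1
      rw [M.lintegral_roundFeedback hs θ h (w h), h1]
      refine (Finset.sum_congr rfl fun z _ => ?_).le
      rw [M.roundLaw_feedback, M.roundLaw_feedback, mul_left_comm, hwm]
    have hprod : ∀ h, weightProd w h = ENNReal.ofReal (((q : ℝ) / x) ^ obsCount obs true h *
        ((1 - q) / (1 - x)) ^ obsCount obs false h) := by
      intro h
      have hr1 : 0 ≤ (q : ℝ) / x := by positivity
      have hr2 : 0 ≤ (1 - (q : ℝ)) / (1 - x) :=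
        div_nonneg (by linarith) (by linarith)
      induction h using List.reverseRecOn with
      | nil => simp [obsCount]
      | append_singleton h z ih =>
        rw [weightProd_append, ih, ← ENNReal.ofReal_mul (by positivity)]
        congr 1
        rcases hz : obs z with _ | _ | _ <;> simp [obsCount_append, hz, obsProb] <;> ring
    filter_upwards [M.ae_bounded_weightProd hs θ hw] with ω ⟨K, hK⟩ _ _
    refine ⟨K, fun n => ?_⟩
    have := hK n
    rw [hprod, ← ENNReal.ofReal_natCast] at this
    exact (ENNReal.ofReal_lt_ofReal_iff_of_nonneg (by
      have hr2 : 0 ≤ (1 - (q : ℝ)) / (1 - x) := div_nonneg (by linarith) (by linarith)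
      positivity)).1 this
  filter_upwards [hb] with ω hω hn
  exact tendsto_frequency hx0 hx1 hω hn

/-! ### Factorization and positivity of the likelihood -/

/-- The likelihood is a product over the businesses of the likelihoods of the observations. -/
lemma exists_likelihood_eq (hs : ∀ h p, MeasurableSet {v | s h v = p}) (h : List (Feedback m)) :
    ∃ C : ENNReal, C ≠ ⊤ ∧ ∀ θ, M.likelihood s h θ = C *
      ∏ k, ENNReal.ofReal (obsLikelihood (fitObs k) h (θ k).1) *
        ENNReal.ofReal (obsLikelihood (qualityObs k) h (θ k).2) := by
  induction h using List.reverseRecOn with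
  | nil =>
    refine ⟨1, by simp, fun θ => ?_⟩
    simp [likelihood, history, obsLikelihood, obsCount]
  | append_singleton h z ih =>
    obtain ⟨C, hC, ih⟩ := ih
    refine ⟨C * (M.valueLaw : Measure ℝ) {v | ∃ x, feedback (s h v) x = z},
      ENNReal.mul_ne_top hC (measure_ne_top _ _), fun θ => ?_⟩
    rw [M.likelihood_append hs, ih, M.roundLaw_feedback, feedbackProb, mul_mul_mul_comm,
      ← Finset.prod_mul_distrib]
    congr 1
    refine Finset.prod_congr rfl fun k _ => ?_
    rw [obsLikelihood_append, obsLikelihood_append,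
      ENNReal.ofReal_mul (obsLikelihood_nonneg _ _ _),
      ENNReal.ofReal_mul (obsLikelihood_nonneg _ _ _), mul_mul_mul_comm]

/-- Almost surely, the history always has positive probability. -/
lemma ae_likelihood_ne_zero (θ : Params m) :
    ∀ᵐ ω ∂M.law θ, ∀ n, M.likelihood s (history s ω n) θ ≠ 0 := by
  -- There are only countably many histories, and each one of likelihood zero is a null event.
  have h : ∀ᵐ ω ∂M.law θ, ∀ h : {h : List (Feedback m) // M.likelihood s h θ = 0},
      history s ω h.1.length ≠ h.1 := by
    refine ae_all_iff.2 fun h => ?_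
    have := h.2
    simpa [ae_iff, likelihood] using this
  filter_upwards [h] with ω hω n h0
  exact hω ⟨_, h0⟩ (by rw [length_history])

end Market

/-- Changing the fit probability of `j` only changes the likelihood of the observed fits of `j`. -/
lemma exists_feedbackProb_fit {m : ℕ} (θ : Params m) (j : Fin m) (a : unitInterval) :
    ∃ θ' : Params m, ∀ z, ENNReal.ofReal (obsProb (θ j).1 (fitObs j z)) * feedbackProb θ' z
      = ENNReal.ofReal (obsProb a (fitObs j z)) * feedbackProb θ z := by
  refine ⟨Function.update θ j (a, (θ j).2), fun z => ?_⟩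
  have e : ∀ k ∈ Finset.univ.erase j, Function.update θ j (a, (θ j).2) k = θ k := fun k hk =>
    Function.update_of_ne (Finset.ne_of_mem_erase hk) _ _
  unfold feedbackProb
  rw [← Finset.mul_prod_erase _ _ (Finset.mem_univ j),
    ← Finset.mul_prod_erase _ _ (Finset.mem_univ j),
    Finset.prod_congr rfl fun k hk => by rw [e k hk]]
  simp only [Function.update_self]
  ring

/-- Changing the quality of `j` only changes the likelihood of its observed quality. -/
lemma exists_feedbackProb_quality {m : ℕ} (θ : Params m) (j : Fin m) (a : unitInterval) :
    ∃ θ' : Params m, ∀ z, ENNReal.ofReal (obsProb (θ j).2 (qualityObs j z)) * feedbackProb θ' z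
      = ENNReal.ofReal (obsProb a (qualityObs j z)) * feedbackProb θ z := by
  refine ⟨Function.update θ j ((θ j).1, a), fun z => ?_⟩
  have e : ∀ k ∈ Finset.univ.erase j, Function.update θ j ((θ j).1, a) k = θ k := fun k hk =>
    Function.update_of_ne (Finset.ne_of_mem_erase hk) _ _
  unfold feedbackProb
  rw [← Finset.mul_prod_erase _ _ (Finset.mem_univ j),
    ← Finset.mul_prod_erase _ _ (Finset.mem_univ j),
    Finset.prod_congr rfl fun k hk => by rw [e k hk]]
  simp only [Function.update_self]
  ring

/-! ### Bayes' rule -/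

/-- The posterior law for the prior law `μ` and the likelihood `L`. -/
def bayes {X : Type*} [MeasurableSpace X] (μ : Measure X) (L : X → ENNReal) : Measure X :=
  (∫⁻ x, L x ∂μ)⁻¹ • μ.withDensity L

section Bayes

variable {X Y : Type*} [MeasurableSpace X] [MeasurableSpace Y]

lemma bayes_apply (μ : Measure X) (L : X → ENNReal) {S : Set X} (hS : MeasurableSet S) :
    bayes μ L S = (∫⁻ x, L x ∂μ)⁻¹ * ∫⁻ x in S, L x ∂μ := by
  rw [bayes, Measure.smul_apply, withDensity_apply _ hS, smul_eq_mul]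

lemma isProbabilityMeasure_bayes {μ : Measure X} {L : X → ENNReal} (h0 : ∫⁻ x, L x ∂μ ≠ 0)
    (h1 : ∫⁻ x, L x ∂μ ≠ ⊤) : IsProbabilityMeasure (bayes μ L) := by
  refine ⟨?_⟩
  rw [bayes_apply _ _ MeasurableSet.univ, setLIntegral_univ, ENNReal.inv_mul_cancel h0 h1]

lemma bayes_const_mul (μ : Measure X) {L : X → ENNReal} (hL : Measurable L) {C : ENNReal}
    (h0 : C ≠ 0) (h1 : C ≠ ⊤) : bayes μ (fun x => C * L x) = bayes μ L := by
  ext S hS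
  rw [bayes_apply _ _ hS, bayes_apply _ _ hS, lintegral_const_mul _ hL, lintegral_const_mul _ hL,
    ENNReal.mul_inv (Or.inl h0) (Or.inl h1), mul_mul_mul_comm, ENNReal.inv_mul_cancel h0 h1,
    one_mul]

lemma bayes_prod {μ : Measure X} {ν : Measure Y} [SFinite μ] [SFinite ν] {L : X → ENNReal}
    {L' : Y → ENNReal} (hL : Measurable L) (hL' : Measurable L') (h0 : ∫⁻ x, L x ∂μ ≠ 0)
    (h1 : ∫⁻ x, L x ∂μ ≠ ⊤) :
    bayes (μ.prod ν) (fun z => L z.1 * L' z.2) = (bayes μ L).prod (bayes ν L') := by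
  have e : ∫⁻ z, L z.1 * L' z.2 ∂μ.prod ν = (∫⁻ x, L x ∂μ) * ∫⁻ y, L' y ∂ν :=
    lintegral_prod_mul hL.aemeasurable hL'.aemeasurable
  unfold bayes
  rw [Measure.prod_smul_left, Measure.prod_smul_right, prod_withDensity hL hL', e,
    ENNReal.mul_inv (Or.inl h0) (Or.inl h1), smul_smul]

lemma lintegral_pi_prod {ι : Type*} [Fintype ι] {μ : ι → Measure X}
    [∀ i, IsProbabilityMeasure (μ i)] {L : ι → X → ENNReal} (hL : ∀ i, Measurable (L i)) :
    ∫⁻ x, ∏ i, L i (x i) ∂Measure.pi μ = ∏ i, ∫⁻ x, L i x ∂μ i := by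
  have h := iIndepFun_pi (μ := μ) (X := L) fun i => (hL i).aemeasurable
  rw [lintegral_prod_eq_prod_lintegral_of_indepFun Finset.univ _ h
    fun i => (hL i).comp (measurable_pi_apply i)]
  refine Finset.prod_congr rfl fun i _ => ?_
  exact (measurePreserving_eval μ i).lintegral_comp (hL i)

lemma bayes_pi {ι : Type*} [Fintype ι] {μ : ι → Measure X}
    [∀ i, IsProbabilityMeasure (μ i)] {L : ι → X → ENNReal} (hL : ∀ i, Measurable (L i))
    (h0 : ∀ i, ∫⁻ x, L i x ∂μ i ≠ 0) (h1 : ∀ i, ∫⁻ x, L i x ∂μ i ≠ ⊤) :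
    bayes (Measure.pi μ) (fun x => ∏ i, L i (x i)) = Measure.pi fun i => bayes (μ i) (L i) := by
  have hp : ∀ i, IsProbabilityMeasure (bayes (μ i) (L i)) := fun i =>
    isProbabilityMeasure_bayes (h0 i) (h1 i)
  refine (Measure.pi_eq fun S hS => ?_).symm
  rw [bayes_apply _ _ (MeasurableSet.univ_pi hS), lintegral_pi_prod hL,
    ← lintegral_indicator (MeasurableSet.univ_pi hS)]
  have e : ∀ x : ι → X, (Set.pi Set.univ S).indicator (fun x => ∏ i, L i (x i)) x
      = ∏ i, (S i).indicator (L i) (x i) := by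
    classical
    intro x
    by_cases hx : x ∈ Set.pi Set.univ S
    · rw [Set.indicator_of_mem hx]
      exact Finset.prod_congr rfl fun i _ => (Set.indicator_of_mem (hx i trivial) _).symm
    · rw [Set.indicator_of_notMem hx]
      simp only [Set.mem_pi, Set.mem_univ, true_imp_iff, not_forall] at hx
      obtain ⟨i, hi⟩ := hx
      exact (Finset.prod_eq_zero (Finset.mem_univ i) (Set.indicator_of_notMem hi _)).symm
  simp only [e]
  rw [lintegral_pi_prod fun i => (hL i).indicator (hS i),
    ENNReal.prod_inv_distrib fun i _ k _ _ => Or.inl (h0 i), ← Finset.prod_mul_distrib]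
  refine Finset.prod_congr rfl fun i _ => ?_
  rw [bayes_apply _ _ (hS i), lintegral_indicator (hS i)]

lemma lintegral_ne_zero_of_mem_support [TopologicalSpace X] [OpensMeasurableSpace X]
    {μ : Measure X} {x : X} (hx : x ∈ μ.support) {L : X → ENNReal} (hL : Continuous L)
    (hLx : L x ≠ 0) : ∫⁻ y, L y ∂μ ≠ 0 := by
  rw [Ne, lintegral_eq_zero_iff hL.measurable]
  intro h
  have hU : {y | L y ≠ 0} ∈ 𝓝 x := (isOpen_ne.preimage hL).mem_nhds hLx
  exact ((Measure.mem_support_iff_forall x).1 hx _ hU).ne' h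

end Bayes

/-! ### Consistency of the posterior -/

/-- The Bernoulli likelihood of the mean `a` per observation, when the frequency is `t`. -/
def bernoulliRate (t a : ℝ) : ℝ := a ^ t * (1 - a) ^ (1 - t)

lemma bernoulliRate_nonneg (t : ℝ) (a : unitInterval) : 0 ≤ bernoulliRate t a :=
  mul_nonneg (Real.rpow_nonneg a.2.1 _) (Real.rpow_nonneg (sub_nonneg.2 a.2.2) _)

lemma bernoulliRate_self_pos (x : unitInterval) : 0 < bernoulliRate x x := by
  rcases eq_or_lt_of_le x.2.1 with h0 | h0
  · simp [bernoulliRate, ← h0]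
  rcases eq_or_lt_of_le x.2.2 with h1 | h1
  · simp [bernoulliRate, h1]
  exact mul_pos (Real.rpow_pos_of_pos h0 _) (Real.rpow_pos_of_pos (by linarith) _)

/-- Gibbs' inequality: the log of the ratio of the two sides is a relative entropy. Endpoints are
treated apart because the logarithms degenerate there; the convention `0 ^ 0 = 1` gives the right
rate for `x` equal to `0` or `1`. -/
lemma bernoulliRate_lt {x a : unitInterval} (hne : a ≠ x) :
    bernoulliRate x a < bernoulliRate x x := by
  have hne' : (x : ℝ) ≠ a := fun h => hne (Subtype.ext h.symm)
  have ha0' := a.2.1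
  have ha1' := a.2.2
  rcases eq_or_lt_of_le x.2.1 with hx0 | hx0
  · have : 0 < (a : ℝ) := lt_of_le_of_ne a.2.1 (hx0 ▸ hne')
    simp [bernoulliRate, ← hx0, this]
  rcases eq_or_lt_of_le x.2.2 with hx1 | hx1
  · have : (a : ℝ) < 1 := lt_of_le_of_ne a.2.2 (hx1 ▸ hne'.symm)
    simp [bernoulliRate, hx1, this]
  have hpos := bernoulliRate_self_pos x
  have hx1' : 0 < 1 - (x : ℝ) := by linarith
  rcases eq_or_lt_of_le ha0' with ha0 | ha0
  · refine lt_of_eq_of_lt ?_ hpos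
    simp [bernoulliRate, ← ha0, Real.zero_rpow hx0.ne']
  rcases eq_or_lt_of_le ha1' with ha1 | ha1
  · refine lt_of_eq_of_lt ?_ hpos
    simp [bernoulliRate, ha1, Real.zero_rpow hx1'.ne']
  have ha1' : 0 < 1 - (a : ℝ) := by linarith
  have h := entropy_pos hx0 hx1 ha0 ha1 hne'
  rw [Real.log_div hx0.ne' ha0.ne', Real.log_div hx1'.ne' ha1'.ne'] at h
  refine (Real.log_lt_log_iff (mul_pos (Real.rpow_pos_of_pos ha0 _)
    (Real.rpow_pos_of_pos ha1' _)) hpos).1 ?_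
  unfold bernoulliRate
  rw [Real.log_mul (Real.rpow_pos_of_pos ha0 _).ne'
    (Real.rpow_pos_of_pos ha1' _).ne', Real.log_mul (Real.rpow_pos_of_pos hx0 _).ne'
    (Real.rpow_pos_of_pos hx1' _).ne', Real.log_rpow ha0, Real.log_rpow ha1', Real.log_rpow hx0,
    Real.log_rpow hx1']
  linarith

lemma continuous_bernoulliRate (x : unitInterval) :
    Continuous fun a : unitInterval => bernoulliRate x a := by
  unfold bernoulliRate
  refine Continuous.mul ?_ ?_
  · exact continuous_subtype_val.rpow_const fun a => Or.inr x.2.1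
  · exact (continuous_const.sub continuous_subtype_val).rpow_const
      fun a => Or.inr (sub_nonneg.2 x.2.2)

lemma pow_mul_pow_eq_bernoulliRate {s f : ℕ} (h : 0 < s + f) (a : unitInterval) :
    (a : ℝ) ^ s * (1 - (a : ℝ)) ^ f
      = bernoulliRate ((s : ℝ) / ((s + f : ℕ) : ℝ)) a ^ (s + f) := by
  have hne : ((s + f : ℕ) : ℝ) ≠ 0 := by exact_mod_cast h.ne'
  have e1 : (s : ℝ) / ((s + f : ℕ) : ℝ) * ((s + f : ℕ) : ℝ) = s := div_mul_cancel₀ _ hne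
  have e2 : (1 - (s : ℝ) / ((s + f : ℕ) : ℝ)) * ((s + f : ℕ) : ℝ) = f := by
    rw [sub_mul, e1]; push_cast; ring
  rw [bernoulliRate, mul_pow, ← Real.rpow_natCast (_ ^ _) (s + f), ← Real.rpow_mul a.2.1, e1,
    ← Real.rpow_natCast (_ ^ _) (s + f), ← Real.rpow_mul (sub_nonneg.2 a.2.2), e2,
    Real.rpow_natCast, Real.rpow_natCast]

/-- If the likelihoods decay faster on `S` than near the point `x` of the support, the posterior
mass of `S` tends to zero. -/
lemma tendsto_bayes_zero {F : Measure unitInterval} [IsFiniteMeasure F] {x : unitInterval}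
    (hx : x ∈ F.support) {L : ℕ → unitInterval → ENNReal} {S U : Set unitInterval}
    (hS : MeasurableSet S) (hU : U ∈ 𝓝 x) {r₁ r₂ : ENNReal} (hr : r₁ < r₂) (hr₂ : r₂ ≠ ⊤)
    {k : ℕ → ℕ} (hk : Tendsto k atTop atTop)
    (h1 : ∀ᶠ n in atTop, ∀ a ∈ S, L n a ≤ r₁ ^ k n)
    (h2 : ∀ᶠ n in atTop, ∀ a ∈ U, r₂ ^ k n ≤ L n a) :
    Tendsto (fun n => bayes F (L n) S) atTop (𝓝 0) := by
  obtain ⟨V, hVU, hV, hxV⟩ := mem_nhds_iff.1 hU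
  have hFV : F V ≠ 0 := ((Measure.mem_support_iff_forall x).1 hx V (hV.mem_nhds hxV)).ne'
  have hr0 : r₂ ≠ 0 := (zero_le.trans_lt hr).ne'
  -- The posterior mass of `S` is at most the bound `r₁ ^ k n * F univ` for the numerator over the
  -- bound `r₂ ^ k n * F V` for the evidence; `F V > 0` by the support assumption.
  have hlim : Tendsto (fun n => (F V)⁻¹ * ((r₁ / r₂) ^ k n * F Set.univ)) atTop (𝓝 0) := by
    have hq : r₁ / r₂ < 1 := ENNReal.div_lt_of_lt_mul (by simpa using hr)
    have h := (ENNReal.tendsto_pow_atTop_nhds_zero_of_lt_one hq).comp hk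
    have h' := ENNReal.Tendsto.mul_const h (b := F Set.univ) (Or.inr (measure_ne_top _ _))
    have h'' := ENNReal.Tendsto.const_mul (a := (F V)⁻¹) h' (Or.inr (by simpa using hFV))
    simpa using h''
  refine tendsto_of_tendsto_of_tendsto_of_le_of_le' tendsto_const_nhds hlim
    (Eventually.of_forall fun _ => zero_le) ?_
  filter_upwards [h1, h2] with n h1 h2
  have hnum : ∫⁻ a in S, L n a ∂F ≤ r₁ ^ k n * F Set.univ := by
    calc ∫⁻ a in S, L n a ∂F ≤ ∫⁻ _ in S, r₁ ^ k n ∂F := setLIntegral_mono' hS h1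
      _ = r₁ ^ k n * F S := by simp
      _ ≤ _ := by gcongr; exact Set.subset_univ _
  have hden : r₂ ^ k n * F V ≤ ∫⁻ a, L n a ∂F := by
    calc r₂ ^ k n * F V = ∫⁻ _ in V, r₂ ^ k n ∂F := by simp
      _ ≤ ∫⁻ a in V, L n a ∂F := setLIntegral_mono' hV.measurableSet fun a ha => h2 a (hVU ha)
      _ ≤ _ := setLIntegral_le_lintegral _ _
  rw [bayes_apply _ _ hS]
  calc (∫⁻ a, L n a ∂F)⁻¹ * ∫⁻ a in S, L n a ∂F
      ≤ (r₂ ^ k n * F V)⁻¹ * (r₁ ^ k n * F Set.univ) := by gcongr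
    _ = (F V)⁻¹ * ((r₁ / r₂) ^ k n * F Set.univ) := by
        rw [ENNReal.mul_inv (Or.inl (pow_ne_zero _ hr0)) (Or.inl (ENNReal.pow_ne_top hr₂)),
          ENNReal.div_eq_inv_mul, mul_pow, ENNReal.inv_pow]
        ring

/-- The posterior law of a mean in the support of the prior law concentrates at it when the
frequencies converge to it; if it is `0` or `1`, all the observations have to agree. -/
theorem beliefsConvergeTo_bayes {F : Measure unitInterval} [IsFiniteMeasure F] {x : unitInterval}
    (hx : x ∈ F.support) {s f : ℕ → ℕ} (hn : Tendsto (fun n => s n + f n) atTop atTop)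
    (hlim : 0 < (x : ℝ) → (x : ℝ) < 1 →
      Tendsto (fun n => (s n : ℝ) / ((s n + f n : ℕ) : ℝ)) atTop (𝓝 (x : ℝ)))
    (h0 : (x : ℝ) = 0 → ∀ n, s n = 0) (h1 : (x : ℝ) = 1 → ∀ n, f n = 0) :
    BeliefsConvergeTo
      (fun n => bayes F fun a => ENNReal.ofReal ((a : ℝ) ^ s n * (1 - (a : ℝ)) ^ f n)) x := by
  -- Joint convergence in time and mean. For interior `x` it is continuity of real powers; for `x`
  -- equal to `0` or `1` that continuity fails at zero base, but there the frequency is eventually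
  -- equal to `x`.
  have hjoint : ∀ a : unitInterval, Tendsto
      (fun p : ℕ × unitInterval => bernoulliRate ((s p.1 : ℝ) / ((s p.1 + f p.1 : ℕ) : ℝ)) p.2)
      (atTop ×ˢ 𝓝 a) (𝓝 (bernoulliRate x a)) := by
    intro a
    have hconst : (∀ᶠ n in atTop, (s n : ℝ) / ((s n + f n : ℕ) : ℝ) = x) → Tendsto
        (fun p : ℕ × unitInterval => bernoulliRate ((s p.1 : ℝ) / ((s p.1 + f p.1 : ℕ) : ℝ)) p.2)
        (atTop ×ˢ 𝓝 a) (𝓝 (bernoulliRate x a)) := by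
      intro h
      refine (((continuous_bernoulliRate x).tendsto a).comp tendsto_snd).congr' ?_
      filter_upwards [tendsto_fst.eventually h] with p hp
      simp only [Function.comp, hp]
    rcases eq_or_lt_of_le x.2.1 with hx0 | hx0
    · exact hconst (Eventually.of_forall fun n => by rw [h0 hx0.symm n, ← hx0]; simp)
    rcases eq_or_lt_of_le x.2.2 with hx1 | hx1
    · refine hconst ?_
      filter_upwards [hn.eventually_gt_atTop 0] with n hp
      have := h1 hx1 n
      rw [this, add_zero] at hp ⊢
      rw [hx1]
      exact div_self (by exact_mod_cast hp.ne')
    have ht : Tendsto (fun p : ℕ × unitInterval => (s p.1 : ℝ) / ((s p.1 + f p.1 : ℕ) : ℝ))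
        (atTop ×ˢ 𝓝 a) (𝓝 (x : ℝ)) := (hlim hx0 hx1).comp tendsto_fst
    have ha : Tendsto (fun p : ℕ × unitInterval => (p.2 : ℝ)) (atTop ×ˢ 𝓝 a) (𝓝 (a : ℝ)) :=
      (continuous_subtype_val.tendsto a).comp tendsto_snd
    exact (ha.rpow ht (Or.inr hx0)).mul
      ((ha.const_sub 1).rpow (ht.const_sub 1) (Or.inr (by linarith)))
  intro ε hε
  let S : Set unitInterval := {a | ε ≤ |(a : ℝ) - (x : ℝ)|}
  have hSc : IsClosed S := isClosed_le continuous_const (by fun_prop)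
  obtain ⟨M, hM0, hM, hMS⟩ : ∃ M : ℝ, 0 ≤ M ∧ M < bernoulliRate x x ∧
      ∀ a ∈ S, bernoulliRate x a ≤ M := by
    rcases S.eq_empty_or_nonempty with he | hne
    · exact ⟨0, le_rfl, bernoulliRate_self_pos x, by simp [he]⟩
    · obtain ⟨a, ha, hmax⟩ := hSc.isCompact.exists_isMaxOn hne
        (continuous_bernoulliRate x).continuousOn
      refine ⟨bernoulliRate x a, bernoulliRate_nonneg _ a, bernoulliRate_lt ?_,
        fun b hb => hmax hb⟩
      rintro rfl
      have : ε ≤ |(a : ℝ) - a| := ha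
      simp at this
      linarith
  -- Two thresholds separate the maximal rate away from `x` from the rate at `x`: `M < r₁ < r₂ <
  -- bernoulliRate x x`.
  obtain ⟨r₁, hr1, hr1'⟩ := exists_between hM
  obtain ⟨r₂, hr2, hr2'⟩ := exists_between hr1'
  have hr10 : 0 ≤ r₁ := hM0.trans hr1.le
  have hfar : ∀ᶠ n in atTop, ∀ a ∈ S,
      bernoulliRate ((s n : ℝ) / ((s n + f n : ℕ) : ℝ)) a < r₁ := by
    -- Compactness of `S` makes the pointwise joint limits uniform over `S`.
    have h := hSc.isCompact.mem_prod_nhdsSet_of_forall (l := atTop)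
      (s := {p : ℕ × unitInterval |
        bernoulliRate ((s p.1 : ℝ) / ((s p.1 + f p.1 : ℕ) : ℝ)) p.2 < r₁})
      fun a ha => (hjoint a).eventually_lt_const ((hMS a ha).trans_lt hr1)
    obtain ⟨t, ht, u, hu, htu⟩ := mem_prod_iff.1 h
    filter_upwards [ht] with n hn a ha
    exact htu (Set.mk_mem_prod hn (subset_of_mem_nhdsSet hu ha))
  obtain ⟨t, ht, U, hU, htU⟩ := mem_prod_iff.1 ((hjoint x).eventually_const_lt hr2')
  refine tendsto_bayes_zero hx hSc.measurableSet hU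
    (r₁ := ENNReal.ofReal r₁) (r₂ := ENNReal.ofReal r₂)
    ((ENNReal.ofReal_lt_ofReal_iff_of_nonneg hr10).2 hr2) ENNReal.ofReal_ne_top hn ?_ ?_
  · filter_upwards [hfar, hn.eventually_gt_atTop 0] with n h hp a ha
    rw [pow_mul_pow_eq_bernoulliRate hp, ← ENNReal.ofReal_pow hr10]
    exact ENNReal.ofReal_le_ofReal (pow_le_pow_left₀ (bernoulliRate_nonneg _ a) (h a ha).le _)
  · filter_upwards [ht, hn.eventually_gt_atTop 0] with n h hp a ha
    rw [pow_mul_pow_eq_bernoulliRate hp, ← ENNReal.ofReal_pow (hr10.trans hr2.le)]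
    have hlt : r₂ < bernoulliRate ((s n : ℝ) / ((s n + f n : ℕ) : ℝ)) a :=
      htU (Set.mk_mem_prod h ha)
    exact ENNReal.ofReal_le_ofReal (pow_le_pow_left₀ (hr10.trans hr2.le) hlt.le _)

/-- Convergence in probability to a constant implies weak convergence. -/
lemma BeliefsConvergeTo.beliefsConverge {μ : ℕ → Measure unitInterval} {a : unitInterval}
    (h : BeliefsConvergeTo μ a) (hp : ∀ n, IsProbabilityMeasure (μ n)) :
    ∃ ν, BeliefsConverge μ ν := by
  refine ⟨⟨Measure.dirac a, inferInstance⟩, fun n => ⟨μ n, hp n⟩, fun n => rfl, ?_⟩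
  refine tendsto_of_forall_isOpen_le_liminf' fun G hG => ?_
  by_cases ha : a ∈ G
  swap
  · simp [hG.measurableSet, ha]
  obtain ⟨ε, hε, hball⟩ := Metric.isOpen_iff.1 hG a ha
  have hlim : Tendsto (fun n => 1 - μ n {x | ε ≤ |(x : ℝ) - (a : ℝ)|}) atTop (𝓝 1) := by
    simpa using ENNReal.Tendsto.sub tendsto_const_nhds (h ε hε) (Or.inl ENNReal.one_ne_top)
  have h1 : (Measure.dirac a : Measure unitInterval) G = 1 := by simp [hG.measurableSet, ha]
  change (Measure.dirac a : Measure unitInterval) G ≤ liminf (fun n => μ n G) atTop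
  rw [h1, ← hlim.liminf_eq]
  refine liminf_le_liminf (Eventually.of_forall fun n => ?_)
  have hm : MeasurableSet {x : unitInterval | ε ≤ |(x : ℝ) - (a : ℝ)|} :=
    (isClosed_le continuous_const (by fun_prop)).measurableSet
  have := hp n
  rw [← prob_compl_eq_one_sub hm]
  refine measure_mono fun x hx => hball ?_
  simpa [Subtype.dist_eq, Real.dist_eq] using hx

lemma beliefsConverge_of_eventually_eq {μ : ℕ → Measure unitInterval}
    (hp : ∀ n, IsProbabilityMeasure (μ n)) {N : ℕ} (h : ∀ n ≥ N, μ n = μ N) :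
    ∃ ν, BeliefsConverge μ ν := by
  refine ⟨⟨μ N, hp N⟩, fun n => ⟨μ n, hp n⟩, fun n => rfl, ?_⟩
  refine tendsto_const_nhds.congr' ?_
  filter_upwards [eventually_ge_atTop N] with n hn
  exact Subtype.ext (h n hn).symm

/-! ### The posterior beliefs -/

lemma continuous_obsLikelihood {m : ℕ} (obs : Feedback m → Option Bool)
    (h : List (Feedback m)) :
    Continuous fun a : unitInterval => ENNReal.ofReal (obsLikelihood obs h a) := by
  unfold obsLikelihood
  exact ENNReal.continuous_ofReal.comp (by fun_prop)

lemma lintegral_obsLikelihood_ne_top {m : ℕ} (obs : Feedback m → Option Bool)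
    (h : List (Feedback m)) (F : Measure unitInterval) [IsFiniteMeasure F] :
    ∫⁻ a : unitInterval, ENNReal.ofReal (obsLikelihood obs h a) ∂F ≠ ⊤ := by
  refine ne_top_of_le_ne_top (measure_ne_top F Set.univ) ?_
  calc ∫⁻ a : unitInterval, ENNReal.ofReal (obsLikelihood obs h a) ∂F
      ≤ ∫⁻ _ : unitInterval, 1 ∂F := by
        refine lintegral_mono fun a => ENNReal.ofReal_le_one.2 ?_
        exact mul_le_one₀ (pow_le_one₀ a.2.1 a.2.2) (pow_nonneg (sub_nonneg.2 a.2.2) _)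
          (pow_le_one₀ (sub_nonneg.2 a.2.2) (by linarith [a.2.1]))
    _ = F Set.univ := by simp

/-- The mean of a posterior law is in the open unit interval if an interior point of it is in the
support of the prior law and has positive likelihood. -/
lemma mean_bayes_mem_Ioo {F : Measure unitInterval} [IsFiniteMeasure F] {x : unitInterval}
    (hx : x ∈ F.support) (hx0 : 0 < (x : ℝ)) (hx1 : (x : ℝ) < 1)
    {L : unitInterval → ENNReal} (hL : Continuous L) (hLx : L x ≠ 0)
    (hfin : ∫⁻ a, L a ∂F ≠ ⊤) : ∫ a, (a : ℝ) ∂bayes F L ∈ Set.Ioo (0 : ℝ) 1 := by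
  have h0 := lintegral_ne_zero_of_mem_support hx hL hLx
  have := isProbabilityMeasure_bayes h0 hfin
  -- The likelihood is nonzero near `x`, so `x` stays in the support of the posterior; then `a` and
  -- `1 - a`, both positive at `x`, have positive posterior mean.
  have hsupp : x ∈ (bayes F L).support := by
    refine (Measure.mem_support_iff_forall x).2 fun U hU => ?_
    obtain ⟨V, hVU, hV, hxV⟩ := mem_nhds_iff.1 hU
    refine lt_of_lt_of_le ?_ (measure_mono hVU)
    rw [bayes_apply _ _ hV.measurableSet, pos_iff_ne_zero]
    refine mul_ne_zero (by simpa using hfin) ?_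
    rw [Ne, setLIntegral_eq_zero_iff hV.measurableSet hL.measurable]
    intro hae
    have hW : V ∩ {a | L a ≠ 0} ∈ 𝓝 x := (hV.inter (isOpen_ne.preimage hL)).mem_nhds ⟨hxV, hLx⟩
    refine ((Measure.mem_support_iff_forall x).1 hx _ hW).ne' (measure_mono_null ?_ hae)
    exact fun a ha h => ha.2 (h ha.1)
  have hpos : ∀ g : unitInterval → ℝ, Continuous g → (∀ a, 0 ≤ g a) → 0 < g x →
      0 < ∫ a, g a ∂bayes F L := by
    intro g hg hg0 hgx
    rw [integral_pos_iff_support_of_nonneg hg0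
      (hg.integrable_of_hasCompactSupport (HasCompactSupport.of_compactSpace g))]
    exact (Measure.mem_support_iff_forall x).1 hsupp _
      ((isOpen_ne.preimage hg).mem_nhds hgx.ne')
  refine ⟨hpos _ continuous_subtype_val (fun a => a.2.1) hx0, ?_⟩
  have h := hpos (fun a => 1 - (a : ℝ)) (by fun_prop) (fun a => sub_nonneg.2 a.2.2)
    (by linarith)
  rw [integral_sub (integrable_const _) (continuous_subtype_val.integrable_of_hasCompactSupport
      (HasCompactSupport.of_compactSpace _))] at h
  simpa using h

namespace Market

variable {m : ℕ} (M : Market m) {s : Strategy m}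

/-- The posterior law of the fit probability of `k`, in terms of the observed fits of `k`. -/
def fitPosterior (k : Fin m) (h : List (Feedback m)) : Measure unitInterval :=
  bayes (M.fitPrior k) fun a => ENNReal.ofReal (obsLikelihood (fitObs k) h a)

/-- The posterior law of the quality of `k`, in terms of its observed realizations. -/
def qualityPosterior (k : Fin m) (h : List (Feedback m)) : Measure unitInterval :=
  bayes (M.qualityPrior k) fun a => ENNReal.ofReal (obsLikelihood (qualityObs k) h a)

section Posterior

variable {M} (hs : ∀ h p, MeasurableSet {v | s h v = p}) {h : List (Feedback m)}
  (hh : M.likelihood s h M.trueParams ≠ 0)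

include hs hh

lemma obsLikelihood_pos (k : Fin m) : 0 < obsLikelihood (fitObs k) h (M.fit k) ∧
    0 < obsLikelihood (qualityObs k) h (M.quality k) := by
  obtain ⟨C, -, hC⟩ := M.exists_likelihood_eq hs h
  rw [hC] at hh
  have := Finset.prod_ne_zero_iff.1 (right_ne_zero_of_mul hh) k (Finset.mem_univ k)
  simpa [trueParams] using this

lemma isProbabilityMeasure_fitPosterior (k : Fin m) :
    IsProbabilityMeasure (M.fitPosterior k h) :=
  isProbabilityMeasure_bayes (lintegral_ne_zero_of_mem_support (M.fit_mem_support k)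
    (continuous_obsLikelihood _ _) (by simpa using (obsLikelihood_pos hs hh k).1))
    (lintegral_obsLikelihood_ne_top _ _ _)

lemma isProbabilityMeasure_qualityPosterior (k : Fin m) :
    IsProbabilityMeasure (M.qualityPosterior k h) :=
  isProbabilityMeasure_bayes (lintegral_ne_zero_of_mem_support (M.quality_mem_support k)
    (continuous_obsLikelihood _ _) (by simpa using (obsLikelihood_pos hs hh k).2))
    (lintegral_obsLikelihood_ne_top _ _ _)

/-- Under the posterior law, all the parameters are independent. -/
lemma posterior_eq : M.posterior s h
    = Measure.pi fun k => (M.fitPosterior k h).prod (M.qualityPosterior k h) := by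
  obtain ⟨C, hC1, hC⟩ := M.exists_likelihood_eq hs h
  have hC0 : C ≠ 0 := by rw [hC] at hh; exact left_ne_zero_of_mul hh
  let L : Fin m → unitInterval × unitInterval → ENNReal := fun k y =>
    ENNReal.ofReal (obsLikelihood (fitObs k) h y.1) *
      ENNReal.ofReal (obsLikelihood (qualityObs k) h y.2)
  have hf := fun k => (continuous_obsLikelihood (fitObs k) h).measurable
  have hq := fun k => (continuous_obsLikelihood (qualityObs k) h).measurable
  have hL : ∀ k, Measurable (L k) := fun k =>
    ((hf k).comp measurable_fst).mul ((hq k).comp measurable_snd)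
  have hint : ∀ k, ∫⁻ y, L k y ∂((M.fitPrior k : Measure unitInterval).prod
      (M.qualityPrior k : Measure unitInterval)) =
      (∫⁻ a : unitInterval, ENNReal.ofReal (obsLikelihood (fitObs k) h a) ∂M.fitPrior k) *
      ∫⁻ a : unitInterval, ENNReal.ofReal (obsLikelihood (qualityObs k) h a) ∂M.qualityPrior k :=
    fun k => lintegral_prod_mul (hf k).aemeasurable (hq k).aemeasurable
  have hf0 := fun k => lintegral_ne_zero_of_mem_support (M.fit_mem_support k)
    (continuous_obsLikelihood (fitObs k) h) (by simpa using (obsLikelihood_pos hs hh k).1)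
  have hq0 := fun k => lintegral_ne_zero_of_mem_support (M.quality_mem_support k)
    (continuous_obsLikelihood (qualityObs k) h) (by simpa using (obsLikelihood_pos hs hh k).2)
  have e : M.likelihood s h = fun θ => C * ∏ k, L k (θ k) := funext hC
  have hLm : Measurable fun θ : Params m => ∏ k, L k (θ k) :=
    Finset.univ.measurable_fun_prod fun k _ => (hL k).comp (measurable_pi_apply k)
  change bayes M.prior (M.likelihood s h) = _
  rw [e, bayes_const_mul _ hLm hC0 hC1, prior, bayes_pi hL
    (fun k => by rw [hint]; exact mul_ne_zero (hf0 k) (hq0 k))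
    (fun k => by
      rw [hint]
      exact ENNReal.mul_ne_top (lintegral_obsLikelihood_ne_top _ _ _)
        (lintegral_obsLikelihood_ne_top _ _ _))]
  congr 1
  funext k
  exact bayes_prod (hf k) (hq k) (hf0 k) (lintegral_obsLikelihood_ne_top _ _ _)

/-- Histories possible under the truth have positive prior probability because the truth is in the
support. This is what allows rationality to be invoked along the actual history. With zero evidence
the posterior would be the zero measure, not a probability. -/
lemma evidence_ne_zero : M.evidence s h ≠ 0 := by
  intro h0
  have h1 : IsProbabilityMeasure (M.posterior s h) := by
    have := isProbabilityMeasure_fitPosterior hs hh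
    have := isProbabilityMeasure_qualityPosterior hs hh
    rw [posterior_eq hs hh]; infer_instance
  have h2 : M.prior.withDensity (M.likelihood s h) Set.univ = 0 := by
    rw [withDensity_apply _ MeasurableSet.univ, setLIntegral_univ]; exact h0
  have h3 := h1.measure_univ
  rw [posterior, Measure.smul_apply, h2, smul_zero] at h3
  exact zero_ne_one h3

lemma fitBelief_eq (k : Fin m) : M.fitBelief s k h = M.fitPosterior k h := by
  have := isProbabilityMeasure_fitPosterior hs hh
  have := isProbabilityMeasure_qualityPosterior hs hh
  rw [fitBelief, posterior_eq hs hh]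
  have h1 := (measurePreserving_eval
    (fun k => (M.fitPosterior k h).prod (M.qualityPosterior k h)) k).map_eq
  have h2 := Measure.map_map (μ := Measure.pi
    fun k => (M.fitPosterior k h).prod (M.qualityPosterior k h)) measurable_fst
    (measurable_pi_apply k)
  refine h2.symm.trans ?_
  erw [h1]
  exact measurePreserving_fst.map_eq

lemma qualityBelief_eq (k : Fin m) : M.qualityBelief s k h = M.qualityPosterior k h := by
  have := isProbabilityMeasure_fitPosterior hs hh
  have := isProbabilityMeasure_qualityPosterior hs hh
  rw [qualityBelief, posterior_eq hs hh]
  have h1 := (measurePreserving_eval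
    (fun k => (M.fitPosterior k h).prod (M.qualityPosterior k h)) k).map_eq
  have h2 := Measure.map_map (μ := Measure.pi
    fun k => (M.fitPosterior k h).prod (M.qualityPosterior k h)) measurable_snd
    (measurable_pi_apply k)
  refine h2.symm.trans ?_
  erw [h1]
  exact measurePreserving_snd.map_eq

lemma meanFit_mem_Ioo (k : Fin m) : M.meanFit s k h ∈ Set.Ioo (0 : ℝ) 1 := by
  rw [meanFit, fitBelief_eq hs hh]
  exact mean_bayes_mem_Ioo (M.fit_mem_support k) (M.fit_pos k) (M.fit_lt_one k)
    (continuous_obsLikelihood _ _) (by simpa using (obsLikelihood_pos hs hh k).1)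
    (lintegral_obsLikelihood_ne_top _ _ _)

lemma meanQuality_le_one (k : Fin m) : M.meanQuality s k h ≤ 1 := by
  have := isProbabilityMeasure_qualityPosterior hs hh k
  rw [meanQuality, qualityBelief_eq hs hh]
  calc ∫ a : unitInterval, (a : ℝ) ∂M.qualityPosterior k h
      ≤ ∫ _ : unitInterval, (1 : ℝ) ∂M.qualityPosterior k h :=
        integral_mono (continuous_subtype_val.integrable_of_hasCompactSupport
          (HasCompactSupport.of_compactSpace _)) (integrable_const _) fun a => a.2.2
    _ = 1 := by simp

end Posterior

end Market

/-! ### Expected utility at the posterior means -/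

lemma sum_prod_bool {m : ℕ} (g : Fin m → Bool → ℝ) :
    ∑ F : Fin m → Bool, ∏ k, g k (F k) = ∏ k, (g k true + g k false) := by
  have h := Finset.prod_univ_sum (fun _ : Fin m => (Finset.univ : Finset Bool)) g
  simp only [Fintype.piFinset_univ, Fintype.sum_bool] at h
  exact h.symm

/-- The probability of the fits `F` when the fits in `K` are known, and the others are independent
with means `a`. -/
def fitsWeight {m : ℕ} (a : Fin m → ℝ) (K : Fin m → Option Bool) (F : Fin m → Bool) : ℝ :=
  ∏ k, (K k).elim (obsProb (a k) (some (F k))) fun c => if F k = c then 1 else 0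

lemma sum_fitsWeight {m : ℕ} (a : Fin m → ℝ) (K : Fin m → Option Bool) :
    ∑ F, fitsWeight a K F = 1 := by
  unfold fitsWeight
  rw [sum_prod_bool fun k b => (K k).elim (obsProb (a k) (some b)) fun c => if b = c then 1 else 0]
  refine Finset.prod_eq_one fun k _ => ?_
  rcases K k with _ | _ | _ <;> simp [obsProb]

lemma fitsWeight_eq_zero {m : ℕ} {a : Fin m → ℝ} {K : Fin m → Option Bool} {F : Fin m → Bool}
    {k : Fin m} {c : Bool} (hk : K k = some c) (hF : F k ≠ c) : fitsWeight a K F = 0 :=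
  Finset.prod_eq_zero (Finset.mem_univ k) (by simp [hk, hF])

/-- The law of total probability over the fit of `k`; it drives the recursion below. -/
lemma fitsWeight_split {m : ℕ} (a : Fin m → ℝ) {K : Fin m → Option Bool} (F : Fin m → Bool)
    {k : Fin m} (hk : K k = none) : fitsWeight a K F
      = a k * fitsWeight a (Function.update K k (some true)) F
        + (1 - a k) * fitsWeight a (Function.update K k (some false)) F := by
  have e : ∀ c, fitsWeight a (Function.update K k (some c)) F = (if F k = c then 1 else 0) *
      ∏ i ∈ Finset.univ.erase k,
        (K i).elim (obsProb (a i) (some (F i))) fun c => if F i = c then 1 else 0 := by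
    intro c
    unfold fitsWeight
    rw [← Finset.mul_prod_erase _ _ (Finset.mem_univ k)]
    congr 1
    · simp
    · refine Finset.prod_congr rfl fun i hi => ?_
      rw [Function.update_of_ne (Finset.ne_of_mem_erase hi)]
  rw [e, e]
  unfold fitsWeight
  rw [← Finset.mul_prod_erase _ _ (Finset.mem_univ k), hk]
  cases hF : F k <;> simp [obsProb]

/-- The utility of a plan when the fits are `F`, averaged over independent qualities with means
`b`. -/
def fitsUtility {m : ℕ} (M : Market m) (b : Fin m → ℝ) (v : ℝ) (p : SearchPlan m)
    (F : Fin m → Bool) : ℝ :=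
  ((p.choice F).elim 0 fun k => (if F k = true then v * b k else 0) - M.price k)
    - M.cost * ((p.inspected F).card : ℝ)

/-- Links the recursive `value` of dynamic programming to the plain expectation over all fit
profiles, by conditioning on the first inspected fit. -/
lemma SearchPlan.sum_fitsWeight_mul {m : ℕ} (M : Market m) (a b : Fin m → ℝ) (v : ℝ) :
    ∀ {p : SearchPlan m} {K : Fin m → Option Bool}, p.Feasible (known K) →
      ∑ F, fitsWeight a K F * fitsUtility M b v p F = p.value M a b v K
  | finish none, K, _ => by simp [fitsUtility, choice, inspected, value]
  | finish (some k), K, hp => by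
      obtain ⟨c, hc⟩ := Option.ne_none_iff_exists'.1 (mem_known.1 hp)
      have e : ∀ F, fitsWeight a K F * fitsUtility M b v (finish (some k)) F
          = fitsWeight a K F * (finish (some k) : SearchPlan m).value M a b v K := by
        intro F
        by_cases hF : F k = c
        · simp [fitsUtility, choice, inspected, value, hc, hF]
        · simp [fitsWeight_eq_zero hc hF]
      rw [Finset.sum_congr rfl fun F _ => e F, ← Finset.sum_mul, sum_fitsWeight, one_mul]
  | inspect k next, K, hp => by
      have hk : K k = none := by simpa [mem_known] using hp.1
      have ih := fun c => sum_fitsWeight_mul M a b v (p := next c)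
        (K := Function.update K k (some c)) (by rw [known_update]; exact hp.2 c)
      have e : ∀ c F, fitsWeight a (Function.update K k (some c)) F *
          fitsUtility M b v (inspect k next) F
          = fitsWeight a (Function.update K k (some c)) F * fitsUtility M b v (next c) F
            - M.cost * fitsWeight a (Function.update K k (some c)) F := by
        intro c F
        by_cases hF : F k = c
        -- Since `k` is never inspected again, the first inspection adds exactly one cost.
        · have hnot : k ∉ (next c).inspected F :=
            (hp.2 c).notMem_inspected (Finset.mem_insert_self k _)
          simp only [fitsUtility, choice, inspected, hF, Finset.card_insert_of_notMem hnot]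
          push_cast
          ring
        · simp [fitsWeight_eq_zero (K := Function.update K k (some c)) (by simp) hF]
      have e2 : ∀ c, ∑ F, fitsWeight a (Function.update K k (some c)) F *
          fitsUtility M b v (inspect k next) F
          = (next c).value M a b v (Function.update K k (some c)) - M.cost := by
        intro c
        rw [Finset.sum_congr rfl fun F _ => e c F, Finset.sum_sub_distrib, ih, ← Finset.mul_sum,
          sum_fitsWeight, mul_one]
      have e3 : ∀ F, fitsWeight a K F * fitsUtility M b v (inspect k next) F
          = a k * (fitsWeight a (Function.update K k (some true)) F *
              fitsUtility M b v (inspect k next) F)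
            + (1 - a k) * (fitsWeight a (Function.update K k (some false)) F *
              fitsUtility M b v (inspect k next) F) := by
        intro F
        rw [fitsWeight_split a F hk]
        ring
      rw [Finset.sum_congr rfl fun F _ => e3 F, Finset.sum_add_distrib, ← Finset.mul_sum,
        ← Finset.mul_sum, e2, e2]
      simp only [value]
      ring

lemma sum_quality_mul_utility {m : ℕ} (M : Market m) (b : Fin m → ℝ) (v : ℝ) (p : SearchPlan m)
    (F : Fin m → Bool) :
    ∑ q : Fin m → Bool, (∏ k, obsProb (b k) (some (q k))) * M.utility p v (F, q)
      = fitsUtility M b v p F := by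
  have h1 : ∑ q : Fin m → Bool, ∏ k, obsProb (b k) (some (q k)) = 1 := by
    rw [sum_prod_bool fun k c => obsProb (b k) (some c)]
    exact Finset.prod_eq_one fun k _ => by simp [obsProb]
  have h2 : ∀ k, ∑ q : Fin m → Bool, (∏ i, obsProb (b i) (some (q i))) *
      (if q k = true then 1 else 0) = b k := by
    intro k
    -- The indicator is absorbed into the factor of `k`, so that the sum factorizes.
    have e : ∀ q : Fin m → Bool, (∏ i, obsProb (b i) (some (q i))) *
        (if q k = true then 1 else 0)
        = ∏ i, obsProb (b i) (some (q i)) * (if i = k then if q i = true then 1 else 0 else 1) := by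
      intro q
      rw [Finset.prod_mul_distrib, Finset.prod_ite_eq' Finset.univ k]
      simp
    rw [Finset.sum_congr rfl fun q _ => e q, sum_prod_bool fun i c =>
      obsProb (b i) (some c) * (if i = k then if c = true then 1 else 0 else 1),
      Finset.prod_eq_single k]
    · simp [obsProb]
    · intro i _ hi
      simp [hi, obsProb]
    · simp
  rcases hc : p.choice F with _ | k
  · simp only [Market.utility, fitsUtility, hc, Option.elim_none, ← Finset.sum_mul, h1, one_mul]
  · have e : ∀ q : Fin m → Bool, (∏ i, obsProb (b i) (some (q i))) * M.utility p v (F, q)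
        = (if F k = true then v else 0) * ((∏ i, obsProb (b i) (some (q i))) *
            (if q k = true then 1 else 0))
          + (∏ i, obsProb (b i) (some (q i))) *
            (- M.price k - M.cost * ((p.inspected F).card : ℝ)) := by
      intro q
      by_cases hF : F k = true <;> by_cases hq : q k = true <;>
        (simp [Market.utility, hc, hF, hq]; try ring)
    rw [Finset.sum_congr rfl fun q _ => e q, Finset.sum_add_distrib, ← Finset.mul_sum, h2,
      ← Finset.sum_mul, h1]
    by_cases hF : F k = true <;> (simp [fitsUtility, hc, hF]; try ring)

lemma signalLaw_real_singleton {m : ℕ} (θ : Params m) (x : Signals m) :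
    (signalLaw θ).real {x} = ∏ k, obsProb (θ k).1 (some (x.1 k)) * obsProb (θ k).2 (some (x.2 k)) := by
  have hb : ∀ (y : unitInterval) (c : Bool), bernoulliMeasure true false y {c}
      = ENNReal.ofReal (obsProb y (some c)) := by
    intro y c
    rw [← bernoulliMeasure_obs]
    congr 1
    ext d
    simp
  have h : ({x} : Set (Signals m)) = (Set.pi Set.univ fun k => {x.1 k}) ×ˢ
      (Set.pi Set.univ fun k => {x.2 k}) := by
    rw [Set.univ_pi_singleton, Set.univ_pi_singleton, Set.singleton_prod_singleton]
  rw [measureReal_def, h, signalLaw, Measure.prod_prod, Measure.pi_pi, Measure.pi_pi,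
    ENNReal.toReal_mul, ENNReal.toReal_prod, ENNReal.toReal_prod, Finset.prod_mul_distrib]
  simp only [hb]
  congr 1 <;> exact Finset.prod_congr rfl fun k _ => ENNReal.toReal_ofReal (obsProb_nonneg _ _)

lemma integral_obsProb {μ : Measure unitInterval} [IsProbabilityMeasure μ] (o : Option Bool) :
    ∫ a : unitInterval, obsProb a o ∂μ = obsProb (∫ a : unitInterval, (a : ℝ) ∂μ) o := by
  rcases o with _ | _ | _
  · simp [obsProb]
  · simp only [obsProb]
    rw [integral_sub (integrable_const _) (continuous_subtype_val.integrable_of_hasCompactSupport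
      (HasCompactSupport.of_compactSpace _))]
    simp
  · simp [obsProb]

namespace Market

variable {m : ℕ} {M : Market m} {s : Strategy m}

/-- The probability of each signal profile is multilinear in the parameters, which are independent
under the posterior, so the posterior enters only through its means. -/
lemma expectedUtility_eq (hs : ∀ h p, MeasurableSet {v | s h v = p}) {h : List (Feedback m)}
    (hh : M.likelihood s h M.trueParams ≠ 0) (v : ℝ) {p : SearchPlan m} (hp : p.Feasible ∅) :
    M.expectedUtility s h v p = p.value M (fun k => M.meanFit s k h)
      (fun k => M.meanQuality s k h) v fun _ => none := by
  have hf := isProbabilityMeasure_fitPosterior hs hh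
  have hq := isProbabilityMeasure_qualityPosterior hs hh
  have hI : ∀ (μ : Measure unitInterval) [IsProbabilityMeasure μ] (o : Option Bool),
      Integrable (fun a : unitInterval => obsProb a o) μ := fun μ _ o =>
    (continuous_obsProb o).integrable_of_hasCompactSupport (HasCompactSupport.of_compactSpace _)
  have h1 : ∀ θ : Params m, ∫ x, M.utility p v x ∂signalLaw θ = ∑ x : Signals m,
      (∏ k, obsProb (θ k).1 (some (x.1 k)) * obsProb (θ k).2 (some (x.2 k))) *
        M.utility p v x := by
    intro θ
    rw [integral_fintype .of_finite]
    simp only [signalLaw_real_singleton, smul_eq_mul]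
  rw [expectedUtility, posterior_eq hs hh]
  simp only [h1]
  rw [integral_finsetSum]
  swap
  · intro x _
    refine Integrable.mul_const ?_ _
    exact Integrable.fintype_prod (f := fun k (y : unitInterval × unitInterval) =>
      obsProb y.1 (some (x.1 k)) * obsProb y.2 (some (x.2 k)))
      fun k => (hI _ _).mul_prod (hI _ _)
  have h2 : ∀ x : Signals m, ∫ θ : Params m,
      (∏ k, obsProb (θ k).1 (some (x.1 k)) * obsProb (θ k).2 (some (x.2 k))) * M.utility p v x
        ∂(Measure.pi fun k => (M.fitPosterior k h).prod (M.qualityPosterior k h))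
      = (∏ k, obsProb (M.meanFit s k h) (some (x.1 k))) *
        ((∏ k, obsProb (M.meanQuality s k h) (some (x.2 k))) * M.utility p v x) := by
    intro x
    rw [integral_mul_const, integral_fintype_prod_eq_prod
      (f := fun k (y : unitInterval × unitInterval) =>
        obsProb y.1 (some (x.1 k)) * obsProb y.2 (some (x.2 k))), ← mul_assoc,
      ← Finset.prod_mul_distrib]
    congr 1
    refine Finset.prod_congr rfl fun k _ => ?_
    rw [integral_prod_mul (fun a : unitInterval => obsProb a (some (x.1 k)))
      (fun a : unitInterval => obsProb a (some (x.2 k))), integral_obsProb, integral_obsProb,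
      meanFit, meanQuality, fitBelief_eq hs hh, qualityBelief_eq hs hh]
  rw [Finset.sum_congr rfl fun x _ => h2 x, Fintype.sum_prod_type]
  simp only [← Finset.mul_sum, sum_quality_mul_utility]
  exact SearchPlan.sum_fitsWeight_mul M _ _ v (K := fun _ => none) (by simpa [known] using hp)

/-- The plans of a rational consumer are optimal at the posterior means. -/
lemma IsRational.isOptimal (hs : M.IsRational s) {h : List (Feedback m)}
    (hh : M.likelihood s h M.trueParams ≠ 0) {v : ℝ} (hv : v ∈ Set.Icc 0 M.topValue) :
    (s h v).IsOptimal M (fun k => M.meanFit s k h) (fun k => M.meanQuality s k h) v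
      fun _ => none := by
  have he := evidence_ne_zero hs.measurable hh
  have hk : known (fun _ : Fin m => none) = ∅ := by simp [known]
  refine ⟨hk ▸ hs.feasible h v he hv, fun q hq => ?_⟩
  rw [hk] at hq
  have := hs.optimal h v he hv q hq
  rwa [expectedUtility_eq hs.measurable hh v hq,
    expectedUtility_eq hs.measurable hh v (hs.feasible h v he hv)] at this

end Market

/-! ### Inspections and transactions along the history -/

lemma fitObs_feedback_ne_none {m : ℕ} {p : SearchPlan m} {x : Signals m} {j : Fin m} :
    fitObs j (feedback p x) ≠ none ↔ j ∈ p.inspected x.1 := by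
  by_cases h : j ∈ p.inspected x.1 <;> simp [fitObs, feedback, h]

lemma qualityObs_feedback_ne_none {m : ℕ} {p : SearchPlan m} {x : Signals m} {j : Fin m} :
    qualityObs j (feedback p x) ≠ none ↔ p.choice x.1 = some j := by
  rcases h : p.choice x.1 with _ | k
  · simp [qualityObs, feedback, h]
  · by_cases hk : k = j <;> simp [qualityObs, feedback, h, hk]

section Observations

variable {m : ℕ} {s : Strategy m} {ω : ℕ → Round m} {obs : Feedback m → Option Bool}

/-- The feedback of round `n` in the outcome `ω`. -/
def feedbackAt (s : Strategy m) (ω : ℕ → Round m) (n : ℕ) : Feedback m :=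
  roundFeedback s (history s ω n) (ω n)

lemma history_succ' (n : ℕ) : history s ω (n + 1) = history s ω n ++ [feedbackAt s ω n] := rfl

lemma obsLikelihood_history_eq {N : ℕ} (h : ∀ n ≥ N, obs (feedbackAt s ω n) = none) {n : ℕ}
    (hn : N ≤ n) (x : ℝ) :
    obsLikelihood obs (history s ω n) x = obsLikelihood obs (history s ω N) x := by
  induction n, hn using Nat.le_induction with
  | base => rfl
  | succ n hn ih => rw [history_succ', obsLikelihood_append, h n hn, ih, obsProb, mul_one]

lemma tendsto_obsCount (h : ∃ᶠ n in atTop, obs (feedbackAt s ω n) ≠ none) :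
    Tendsto (fun n => obsCount obs true (history s ω n) + obsCount obs false (history s ω n))
      atTop atTop := by
  have hsucc : ∀ n, obsCount obs true (history s ω (n + 1)) +
      obsCount obs false (history s ω (n + 1)) =
      obsCount obs true (history s ω n) + obsCount obs false (history s ω n) +
        if obs (feedbackAt s ω n) = none then 0 else 1 := by
    intro n
    rw [history_succ', obsCount_append, obsCount_append]
    rcases obs (feedbackAt s ω n) with _ | _ | _ <;> simp <;> omega
  have hmono : Monotone fun n =>
      obsCount obs true (history s ω n) + obsCount obs false (history s ω n) :=
    monotone_nat_of_le_succ fun n => by rw [hsucc]; exact Nat.le_add_right _ _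
  refine tendsto_atTop_atTop_of_monotone hmono fun b => ?_
  induction b with
  | zero => exact ⟨0, Nat.zero_le _⟩
  | succ b ih =>
    obtain ⟨n, hn⟩ := ih
    obtain ⟨k, hk, hobs⟩ := frequently_atTop.1 h n
    refine ⟨k + 1, ?_⟩
    rw [hsucc, if_neg hobs]
    exact Nat.succ_le_succ (hn.trans (hmono hk))

end Observations

namespace Market

variable {m : ℕ} {M : Market m} {s : Strategy m}

lemma ae_value_mem (θ : Params m) : ∀ᵐ ω ∂M.law θ, ∀ n, (ω n).1 ∈ Set.Icc 0 M.topValue := by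
  refine ae_all_iff.2 fun n => ?_
  have h1 : MeasurePreserving (fun ω : ℕ → Round m => ω n) (M.law θ) (M.roundLaw θ) :=
    measurePreserving_eval_infinitePi (fun _ : ℕ => M.roundLaw θ) n
  have h2 : MeasurePreserving Prod.fst (M.roundLaw θ) (M.valueLaw : Measure ℝ) :=
    measurePreserving_fst
  exact (h2.comp h1).quasiMeasurePreserving.ae M.value_mem

/-- At the true parameters, all fits are possible. -/
lemma exists_le_signalLaw (M : Market m) : ∃ ρ : NNReal, 0 < ρ ∧
    ∀ F : Fin m → Bool, ρ ≤ signalLaw M.trueParams {x | x.1 = F} := by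
  have hpos : ∀ F : Fin m → Bool, signalLaw M.trueParams {x | x.1 = F} ≠ 0 := by
    intro F h0
    have h1 : signalLaw M.trueParams {x | x.1 = F} = ∏ k,
        bernoulliMeasure true false (M.fit k) {b | ∀ c, some (F k) = some c → b = c} := by
      have e : {x : Signals m | x.1 = F} = (Set.pi Set.univ fun k =>
          {b | ∀ c, some (F k) = some c → b = c}) ×ˢ Set.univ := by
        ext x
        simp [funext_iff]
      rw [e, signalLaw, Measure.prod_prod, Measure.pi_pi, measure_univ, mul_one]
      rfl
    rw [h1, Finset.prod_eq_zero_iff] at h0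
    obtain ⟨k, -, hk⟩ := h0
    rw [bernoulliMeasure_obs, ENNReal.ofReal_eq_zero] at hk
    exact absurd hk (not_le.2 (obsProb_pos (M.fit_pos k) (M.fit_lt_one k) _))
  obtain ⟨F₀, hF₀⟩ := Finite.exists_min fun F => signalLaw M.trueParams {x | x.1 = F}
  refine ⟨(signalLaw M.trueParams {x | x.1 = F₀}).toNNReal,
    ENNReal.toNNReal_pos (hpos F₀) (measure_ne_top _ _), fun F => ?_⟩
  rw [ENNReal.coe_toNNReal (measure_ne_top _ _)]
  exact hF₀ F

/-- If inspections are costly, a business that is inspected infinitely often transacts infinitely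
often. -/
lemma ae_frequently_transact_of_inspect (hs : M.IsRational s) (hc : 0 < M.cost) (j : Fin m) :
    ∀ᵐ ω ∂M.law M.trueParams, (∃ᶠ n in atTop, fitObs j (feedbackAt s ω n) ≠ none) →
      ∃ᶠ n in atTop, qualityObs j (feedbackAt s ω n) ≠ none := by
  obtain ⟨ρ, hρ, hle⟩ := M.exists_le_signalLaw
  have h := M.ae_frequently_of_frequently hs.measurable M.trueParams
    (B := fun h z => M.likelihood s h M.trueParams ≠ 0 ∧ fitObs j z ≠ none)
    (T := fun _ z => qualityObs j z ≠ none) hρ ?_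
  · filter_upwards [h, M.ae_likelihood_ne_zero (s := s) M.trueParams] with ω hω hpos hB
    exact hω (hB.mono fun n hn => ⟨hpos n, hn⟩)
  intro h
  by_cases hh : M.likelihood s h M.trueParams = 0
  · simp [hh]
  have hm := measurable_roundFeedback hs.measurable h
  have hmB : MeasurableSet {r | M.likelihood s h M.trueParams ≠ 0 ∧
      fitObs j (roundFeedback s h r) ≠ none} :=
    hm (t := {z | M.likelihood s h M.trueParams ≠ 0 ∧ fitObs j z ≠ none}) trivial
  have hmT : MeasurableSet {r | qualityObs j (roundFeedback s h r) ≠ none} :=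
    hm (t := {z | qualityObs j z ≠ none}) trivial
  rw [roundLaw, Measure.prod_apply hmB, Measure.prod_apply hmT,
    ← lintegral_const_mul _ (measurable_measure_prodMk_left hmB)]
  refine lintegral_mono_ae ?_
  filter_upwards [M.value_mem] with v hv
  -- Either some fit profile, of probability at least `ρ`, leads to a transaction with `j`, or the
  -- plan never transacts with `j` and then never inspects it.
  by_cases hex : ∃ F, (s h v).choice F = some j
  · obtain ⟨F, hF⟩ := hex
    calc (ρ : ENNReal) * signalLaw M.trueParams _ ≤ ρ := mul_le_of_le_one_right' prob_le_one
      _ ≤ signalLaw M.trueParams {x | x.1 = F} := hle F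
      _ ≤ _ := measure_mono fun x hx => by
        subst hx
        exact qualityObs_feedback_ne_none.2 hF
  · push Not at hex
    have hno := (hs.isOptimal hh hv).notMem_inspected
      (fun k => (meanFit_mem_Ioo hs.measurable hh k).1)
      (fun k => (meanFit_mem_Ioo hs.measurable hh k).2) hc (j := j) (fun F _ => hex F)
    have e : Prod.mk v ⁻¹' {r | M.likelihood s h M.trueParams ≠ 0 ∧
        fitObs j (roundFeedback s h r) ≠ none} = ∅ := by
      refine Set.eq_empty_of_forall_notMem fun x hx => ?_
      exact hno x.1 (fun k b hkb => by simp at hkb) (fitObs_feedback_ne_none.1 hx.2)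
    rw [e, measure_empty, mul_zero]
    exact zero_le

/-- A business whose index at the top value is infinitely often bounded away from zero
transacts infinitely often. -/
lemma ae_frequently_transact_of_index (hs : M.IsRational s) (j : Fin m) {δ : ℝ} (hδ : 0 < δ) :
    ∀ᵐ ω ∂M.law M.trueParams, (∃ᶠ n in atTop, δ ≤ M.index j (M.meanFit s j (history s ω n))
        (M.meanQuality s j (history s ω n)) M.topValue) →
      ∃ᶠ n in atTop, qualityObs j (feedbackAt s ω n) ≠ none := by
  obtain ⟨ρ, hρ, hle⟩ := M.exists_le_signalLaw
  -- The mean quality is at most `1`, so a value within `δ` of the top lowers the index by less than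
  -- `δ` and keeps it positive. Such values have mass `κ`, and only `j` fits with probability at
  -- least `ρ`.
  let κ : NNReal := ((M.valueLaw : Measure ℝ) (Set.Ioi (M.topValue - δ))).toNNReal
  have hκ : 0 < κ := ENNReal.toNNReal_pos (M.topValue_isTop _ (by linarith)).ne'
    (measure_ne_top _ _)
  have hκ' : (κ : ENNReal) = (M.valueLaw : Measure ℝ) (Set.Ioi (M.topValue - δ)) :=
    ENNReal.coe_toNNReal (measure_ne_top _ _)
  have h := M.ae_frequently_of_frequently hs.measurable M.trueParams
    (B := fun h _ => M.likelihood s h M.trueParams ≠ 0 ∧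
      δ ≤ M.index j (M.meanFit s j h) (M.meanQuality s j h) M.topValue)
    (T := fun _ z => qualityObs j z ≠ none) (mul_pos hκ hρ) ?_
  · filter_upwards [h, M.ae_likelihood_ne_zero (s := s) M.trueParams] with ω hω hpos hB
    exact hω (hB.mono fun n hn => ⟨hpos n, hn⟩)
  intro h
  by_cases hB : M.likelihood s h M.trueParams ≠ 0 ∧
      δ ≤ M.index j (M.meanFit s j h) (M.meanQuality s j h) M.topValue
  swap
  · simp [hB]
  obtain ⟨hh, hidx⟩ := hB
  have hIoi : (M.valueLaw : Measure ℝ) (Set.Ioi (M.topValue - δ))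
      ≤ (M.valueLaw : Measure ℝ) (Set.Ioi (M.topValue - δ) ∩ Set.Icc 0 M.topValue) := by
    refine measure_mono_ae ?_
    filter_upwards [M.value_mem] with v hv hv'
    exact ⟨hv', hv⟩
  calc ((κ * ρ : NNReal) : ENNReal) * M.roundLaw M.trueParams _
      ≤ ((κ * ρ : NNReal) : ENNReal) := mul_le_of_le_one_right' prob_le_one
    _ = κ * ρ := by push_cast; rfl
    _ ≤ (M.valueLaw : Measure ℝ) (Set.Ioi (M.topValue - δ) ∩ Set.Icc 0 M.topValue) *
        signalLaw M.trueParams {x | x.1 = fun k => decide (k = j)} := by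
        rw [hκ']
        exact mul_le_mul' hIoi (hle _)
    _ = M.roundLaw M.trueParams ((Set.Ioi (M.topValue - δ) ∩ Set.Icc 0 M.topValue) ×ˢ
        {x | x.1 = fun k => decide (k = j)}) := (Measure.prod_prod _ _).symm
    _ ≤ M.roundLaw M.trueParams {r | qualityObs j (roundFeedback s h r) ≠ none} := by
        refine measure_mono ?_
        rintro ⟨v, x⟩ ⟨⟨hv, hv'⟩, hx⟩
        have hxF : x.1 = fun k => decide (k = j) := hx
        refine qualityObs_feedback_ne_none.2 ?_
        have hpos : 0 < M.index j (M.meanFit s j h) (M.meanQuality s j h) v := by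
          have h1 := meanQuality_le_one hs.measurable hh j
          have hv1 : M.topValue - δ < v := hv
          have hv2 : v ≤ M.topValue := hv'.2
          unfold index at hidx ⊢
          nlinarith
        have := (hs.isOptimal hh hv').choice_eq
          (fun k => (meanFit_mem_Ioo hs.measurable hh k).1)
          (fun k => (meanFit_mem_Ioo hs.measurable hh k).2) hpos
          (fun k b hkb => by simp at hkb)
        simpa only [hxF] using this

/-! ### Learning from infinitely many observations -/

/-- The beliefs about the fit probability of a business that is inspected infinitely often converge to
the truth. -/
lemma ae_fitBelief_convergeTo (hs : ∀ h p, MeasurableSet {v | s h v = p}) (j : Fin m) :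
    ∀ᵐ ω ∂M.law M.trueParams, (∃ᶠ n in atTop, fitObs j (feedbackAt s ω n) ≠ none) →
      BeliefsConvergeTo (fun i => M.fitBelief s j (history s ω i)) (M.fit j) := by
  have h := M.ae_tendsto_frequency hs M.trueParams (obs := fitObs j) (M.fit_pos j)
    (M.fit_lt_one j) (exists_feedbackProb_fit M.trueParams j)
  filter_upwards [h, M.ae_likelihood_ne_zero (s := s) M.trueParams] with ω hω hpos hinf
  have hn := tendsto_obsCount hinf
  simp only [fitBelief_eq hs (hpos _)]
  exact beliefsConvergeTo_bayes (M.fit_mem_support j) hn (fun _ _ => hω hn)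
    (fun h0 => absurd h0 (M.fit_pos j).ne') (fun h1 => absurd h1 (M.fit_lt_one j).ne)

/-- The beliefs about the quality of a business that transacts infinitely often converge to the
truth. -/
lemma ae_qualityBelief_convergeTo (hs : ∀ h p, MeasurableSet {v | s h v = p}) (j : Fin m) :
    ∀ᵐ ω ∂M.law M.trueParams, (∃ᶠ n in atTop, qualityObs j (feedbackAt s ω n) ≠ none) →
      BeliefsConvergeTo (fun i => M.qualityBelief s j (history s ω i)) (M.quality j) := by
  have h : ∀ᵐ ω ∂M.law M.trueParams, 0 < (M.quality j : ℝ) → (M.quality j : ℝ) < 1 →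
      Tendsto (fun n => obsCount (qualityObs j) true (history s ω n) +
        obsCount (qualityObs j) false (history s ω n)) atTop atTop →
      Tendsto (fun n => (obsCount (qualityObs j) true (history s ω n) : ℝ) /
        ((obsCount (qualityObs j) true (history s ω n) +
          obsCount (qualityObs j) false (history s ω n) : ℕ) : ℝ))
        atTop (𝓝 (M.quality j : ℝ)) := by
    by_cases hq : 0 < (M.quality j : ℝ) ∧ (M.quality j : ℝ) < 1
    · filter_upwards [M.ae_tendsto_frequency hs M.trueParams (obs := qualityObs j) hq.1 hq.2
        (exists_feedbackProb_quality M.trueParams j)] with ω hω _ _ using hω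
    · exact Eventually.of_forall fun ω h0 h1 => absurd ⟨h0, h1⟩ hq
  filter_upwards [h, M.ae_likelihood_ne_zero (s := s) M.trueParams] with ω hω hpos hinf
  have hn := tendsto_obsCount hinf
  simp only [qualityBelief_eq hs (hpos _)]
  have hL := fun n => (obsLikelihood_pos hs (hpos n) j).2
  refine beliefsConvergeTo_bayes (M.quality_mem_support j) hn (fun h0 h1 => hω h0 h1 hn)
    (fun h0 n => ?_) (fun h1 n => ?_)
  -- A success at true quality `0`, or a failure at `1`, would give the observed history zero
  -- likelihood.
  · by_contra hne
    have := hL n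
    simp [obsLikelihood, h0, hne] at this
  · by_contra hne
    have := hL n
    simp [obsLikelihood, h1, hne] at this

end Market

end AgenticMarket

end

/-! ### Assembly: learned or lost -/

theorem mainTheorem3 {m : ℕ} (M : AgenticMarket.Market m) (s : AgenticMarket.Strategy m)
    (hs : M.IsRational s) (j : Fin m) :
    ∀ᵐ ω ∂(M.law M.trueParams),
      (∃ ν₁ ν₂ : MeasureTheory.ProbabilityMeasure unitInterval,
        AgenticMarket.BeliefsConverge
          (fun i => M.fitBelief s j (AgenticMarket.history s ω i)) ν₁ ∧
        AgenticMarket.BeliefsConverge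
          (fun i => M.qualityBelief s j (AgenticMarket.history s ω i)) ν₂) ∧
      (M.Learned s j ω ∨ M.Lost s j ω) := by
  open AgenticMarket AgenticMarket.Market in
  have hm := hs.measurable
  have hinsp : ∀ᵐ ω ∂M.law M.trueParams, 0 < M.cost →
      (∃ᶠ n in atTop, fitObs j (feedbackAt s ω n) ≠ none) →
      ∃ᶠ n in atTop, qualityObs j (feedbackAt s ω n) ≠ none := by
    by_cases hc : 0 < M.cost
    · filter_upwards [ae_frequently_transact_of_inspect hs hc j] with ω hω _ using hω
    · exact Eventually.of_forall fun ω h => absurd h hc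
  -- The thresholds `1 / (k + 1)` cover every positive index with countably many null sets.
  have hidx := ae_all_iff.2 fun k : ℕ => ae_frequently_transact_of_index hs j
    (δ := 1 / ((k : ℝ) + 1)) (by positivity)
  filter_upwards [M.ae_likelihood_ne_zero (s := s) M.trueParams, ae_value_mem M.trueParams,
    ae_fitBelief_convergeTo hm j, ae_qualityBelief_convergeTo hm j, hinsp, hidx]
    with ω hpos hval hfit hqual hinsp hidx
  have hpf : ∀ n, IsProbabilityMeasure (M.fitBelief s j (history s ω n)) := fun n => by
    rw [fitBelief_eq hm (hpos n)]; exact isProbabilityMeasure_fitPosterior hm (hpos n) j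
  have hpq : ∀ n, IsProbabilityMeasure (M.qualityBelief s j (history s ω n)) := fun n => by
    rw [qualityBelief_eq hm (hpos n)]; exact isProbabilityMeasure_qualityPosterior hm (hpos n) j
  have hfix : ∀ N, (∀ n ≥ N, fitObs j (feedbackAt s ω n) = none) → ∀ n ≥ N,
      M.fitBelief s j (history s ω n) = M.fitBelief s j (history s ω N) := by
    intro N hN n hn
    rw [fitBelief_eq hm (hpos n), fitBelief_eq hm (hpos N)]
    simp only [fitPosterior, obsLikelihood_history_eq hN hn]
  have hqix : ∀ N, (∀ n ≥ N, qualityObs j (feedbackAt s ω n) = none) → ∀ n ≥ N,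
      M.qualityBelief s j (history s ω n) = M.qualityBelief s j (history s ω N) := by
    intro N hN n hn
    rw [qualityBelief_eq hm (hpos n), qualityBelief_eq hm (hpos N)]
    simp only [qualityPosterior, obsLikelihood_history_eq hN hn]
  have hev : ∀ {obs : Feedback m → Option Bool},
      ¬ (∃ᶠ n in atTop, obs (feedbackAt s ω n) ≠ none) →
      ∃ N, ∀ n ≥ N, obs (feedbackAt s ω n) = none := by
    intro obs h
    simpa [not_frequently, eventually_atTop] using h
  refine ⟨?_, ?_⟩
  · have h1 : ∃ ν, BeliefsConverge (fun i => M.fitBelief s j (history s ω i)) ν := by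
      by_cases hf : ∃ᶠ n in atTop, fitObs j (feedbackAt s ω n) ≠ none
      · exact (hfit hf).beliefsConverge hpf
      · obtain ⟨N, hN⟩ := hev hf
        exact beliefsConverge_of_eventually_eq hpf (hfix N hN)
    have h2 : ∃ ν, BeliefsConverge (fun i => M.qualityBelief s j (history s ω i)) ν := by
      by_cases hq : ∃ᶠ n in atTop, qualityObs j (feedbackAt s ω n) ≠ none
      · exact (hqual hq).beliefsConverge hpq
      · obtain ⟨N, hN⟩ := hev hq
        exact beliefsConverge_of_eventually_eq hpq (hqix N hN)
    obtain ⟨ν₁, h1⟩ := h1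
    obtain ⟨ν₂, h2⟩ := h2
    exact ⟨ν₁, ν₂, h1, h2⟩
  -- The dichotomy is whether `j` transacts infinitely often; a feasible plan transacts only after
  -- inspecting, so transactions reveal fits too.
  by_cases hq : ∃ᶠ n in atTop, qualityObs j (feedbackAt s ω n) ≠ none
  · refine Or.inl ⟨hfit (hq.mono fun n hn => ?_), hqual hq⟩
    have hch := qualityObs_feedback_ne_none.1 hn
    have hfeas := hs.feasible _ _ (evidence_ne_zero hm (hpos n)) (hval n)
    exact fitObs_feedback_ne_none.2
      ((hfeas.mem_of_choice hch).resolve_left (Finset.notMem_empty j))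
  · refine Or.inr ?_
    by_contra hlost
    simp only [Lost, not_exists, not_forall, not_le] at hlost
    obtain ⟨N, hN⟩ := hev hq
    -- The index is eventually constant. At zero cost the fit belief may keep moving, but the index
    -- ignores it; at positive cost inspections stop with transactions.
    obtain ⟨N', hN'⟩ : ∃ N', ∀ n ≥ N',
        M.index j (M.meanFit s j (history s ω n)) (M.meanQuality s j (history s ω n)) M.topValue
        = M.index j (M.meanFit s j (history s ω N')) (M.meanQuality s j (history s ω N'))
          M.topValue := by
      rcases M.cost_nonneg.eq_or_lt with hc | hc
      · refine ⟨N, fun n hn => ?_⟩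
        simp only [index, ← hc, zero_div, meanQuality, hqix N hN n hn]
      · obtain ⟨N₂, hN₂⟩ := hev fun hf => hq (hinsp hc hf)
        refine ⟨max N N₂, fun n hn => ?_⟩
        have e1 := hqix N hN n (le_of_max_le_left hn)
        have e2 := hqix N hN _ (le_max_left N N₂)
        have e3 := hfix N₂ hN₂ n (le_of_max_le_right hn)
        have e4 := hfix N₂ hN₂ _ (le_max_right N N₂)
        simp only [meanQuality, meanFit, e1, e2, e3, e4]
    -- One positive index after `N'` makes the frozen value positive, so it exceeds some `1 / (k +
    -- 1)` forever and forces infinitely many transactions.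
    obtain ⟨i, hi, hipos⟩ := hlost N'
    rw [hN' i hi] at hipos
    obtain ⟨k, hk⟩ := exists_nat_one_div_lt hipos
    refine hq (hidx k (Eventually.frequently ?_))
    filter_upwards [eventually_ge_atTop N'] with n hn
    rw [hN' n hn]
    exact hk.le
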